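/- Write $e(z)=e^{2\pi i z}$. Let $A$ be a discriminant form, i.e. a finite abelian group with a nondegenerate $\mathbb{Q}/\mathbb{Z}$-valued quadratic form $x\mapsto x^2/2$ and associated bilinear form $(\cdot,\cdot)$. Let $N$ be its level, the least positive integer with $N\cdot x^2/2=0$ in $\mathbb{Q}/\mathbb{Z}$ for all $x\in A$, and let $\mathrm{sig}(A)\in\mathbb{Z}/8\mathbb{Z}$ be its signature, determined by Milgram's formula $\sum_{x\in A}e(x^2/2)=\sqrt{|A|}\,e(\mathrm{sig}(A)/8)$. Assume that $\mathrm{sig}(A)$ is odd, and let $k\in\frac12\mathbb{Z}$. Let $\widetilde{\mathrm{GL}}{}_2^+(\mathbb{R})$ be the metaplectic cover: pairs $(M,\phi)$ with $M=\begin{pmatrix}a&b\\c&d\end{pmatrix}\in\mathrm{GL}_2^+(\mathbb{R})$ and $\phi:\mathbb{H}\to\mathbb{C}$ holomorphic with $\phi(\tau)^2=c\tau+d$, and product $(M,\phi)(M',\phi')=(MM',\phi(M'\tau)\phi'(\tau))$. Let $\tilde\Gamma$ be the preimage of $\mathrm{SL}_2(\mathbb{Z})$, and let $\rho_A:\tilde\Gamma\to\mathrm{U}(\mathbb{C}[A])$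 be the Weil representation, given on the generators $T=\left(\begin{pmatrix}1&1\\0&1\end{pmatrix},1\right)$, $S=\left(\begin{pmatrix}0&-1\\1&0\end{pmatrix},\sqrt\tau\right)$ by $$\rho_A(T)\mathfrak e_\lambda=e(\lambda^2/2)\mathfrak e_\lambda,\qquad \rho_A(S)\mathfrak e_\lambda=\frac{e(-\mathrm{sig}(A)/8)}{\sqrt{|A|}}\sum_{\mu\in A}e(-(\lambda,\mu))\mathfrak e_\mu .$$ Let $M_{k,A}$ be the space of holomorphic $f:\mathbb{H}\to\mathbb{C}[A]$ with $f(M\tau)=\phi(\tau)^{2k}\rho_A(M,\phi)f(\tau)$ for all $(M,\phi)\in\tilde\Gamma$ that are holomorphic at $\infty$. Let $\mathcal G(N)$ be the group of $M\in\mathrm{GL}_2^+(\mathbb{Q})$ for which there is an integer $n$ prime to $N$ with $nM$ integral and $\det(nM)$ prime to $N$; such $M$ can be reduced modulo $N$. Let $\mathcal H(N)\subset\mathcal G(N)$ be the subgroup of matrices whose determinant is a square modulo $N$, and $\widetilde{\mathcal H}(N)$ its preimage in $\widetilde{\mathrm{GL}}{}_2^+(\mathbb{R})$. For $M\in\mathcal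 G(N)$ and $r\in(\mathbb{Z}/N\mathbb{Z})^\times$ with $\det M\equiv r^2\pmod N$, let $\rho_A(M,r)\in\mathrm{U}(\mathbb{C}[A])/\{\pm1\}$ be the class of $\frac{g_1(A)}{g_r(A)}\rho_A(\gamma)$, where $\gamma\in\tilde\Gamma$ lies over a matrix congruent to $r^{-1}M$ modulo $N$ and $g_d(A)=\sum_{x\in A}e(d\,x^2/2)$. Let $\mathcal Q_2(N)$ be the group of tuples $\xi=(M,\phi,r,u)$ with $(M,\phi)\in\widetilde{\mathcal H}(N)$, $r\in(\mathbb{Z}/N\mathbb{Z})^\times$, $\det M\equiv r^2\pmod N$ and $u\in\mathrm{U}(\mathbb{C}[A])$ one of the two elements of the class $\rho_A(M,r)$, with component-wise multiplication. It acts from the right on functions $f:\mathbb{H}\to\mathbb{C}[A]$ by $$(f\mid_{k,A}\xi)(\tau)=\det(M)^{k/2}\phi(\tau)^{-2k}\,u^{-1}f(M\tau).$$ Let $\Delta=\{(M,\phi,1,\rho_A(M,\phi)):(M,\phi)\in\tilde\Gamma\}\subset\mathcal Q_2(N)$. Let $\alpha=(M,\phi)\in\widetilde{\mathcal H}(N)$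 and let $\xi=(\alpha,r,u)\in\mathcal Q_2(N)$ be any lift of $\alpha$. Then $\Delta\xi\Delta$ is a finite disjoint union of cosets $\Delta\xi_i$, and the Hecke operator $$f\mid_{k,A}T(\xi)=\det(M)^{k/2-1}\sum_i f\mid_{k,A}\xi_i\qquad(f\in M_{k,A})$$ vanishes identically on $M_{k,A}$ unless $\det(M)$ is the square of a rational number. -/

import Mathlib

section

open scoped UpperHalfPlane Manifold

/-- The metaplectic cover of `GL₂⁺(ℝ)`: pairs `(M, φ)` with `M ∈ GL₂⁺(ℝ)` and `φ : ℍ → ℂ` holomorphic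
with `φ(τ)² = cτ + d`. -/
@[ext] structure Metaplectic where
  mat : GL (Fin 2) ℝ
  det_pos : 0 < mat.det.val
  phi : ℍ → ℂ
  holo : MDifferentiable 𝓘(ℂ) 𝓘(ℂ) phi
  sq_phi : ∀ τ : ℍ, phi τ ^ 2 = UpperHalfPlane.denom mat τ

end

namespace Metaplectic

open scoped MatrixGroups UpperHalfPlane Manifold
open UpperHalfPlane

noncomputable section

theorem denom_mul_of_pos {g h : GL (Fin 2) ℝ} (hh : 0 < h.det.val) (τ : ℍ) :
    denom (g * h) τ = denom g ↑(h • τ) * denom h τ := by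
  rw [denom_cocycle_σ, σ, if_pos hh]
  rfl

theorem phi_ne_zero (g : Metaplectic) (τ : ℍ) : g.phi τ ≠ 0 := by
  intro h
  have := g.sq_phi τ
  rw [h] at this
  exact denom_ne_zero g.mat τ (by rw [← this]; simp)

/-- `(M, φ(τ)) (M', φ'(τ)) = (M M', φ(M'τ) φ'(τ))`. -/
instance : Mul Metaplectic where
  mul g h :=
    { mat := g.mat * h.mat
      det_pos := by
        rw [map_mul, Units.val_mul]
        exact mul_pos g.det_pos h.det_pos
      phi := fun τ => g.phi (h.mat • τ) * h.phi τ
      holo := (g.holo.comp (mdifferentiable_smul h.det_pos)).mul h.holo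
      sq_phi := fun τ => by
        rw [mul_pow, g.sq_phi, h.sq_phi, denom_mul_of_pos h.det_pos] }

instance : One Metaplectic where
  one :=
    { mat := 1
      det_pos := by simp
      phi := fun _ => 1
      holo := mdifferentiable_const
      sq_phi := fun τ => by simp }

theorem inv_det_pos (g : Metaplectic) : 0 < (g.mat⁻¹).det.val := by
  rw [map_inv, Units.val_inv_eq_inv_val]
  exact inv_pos.mpr g.det_pos

instance : Inv Metaplectic where
  inv g :=
    { mat := g.mat⁻¹
      det_pos := inv_det_pos g
      phi := fun τ => (g.phi (g.mat⁻¹ • τ))⁻¹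
      holo := by
        have h := g.holo.comp (mdifferentiable_smul (inv_det_pos g))
        rw [UpperHalfPlane.mdifferentiable_iff] at h ⊢
        exact h.inv fun z _ => phi_ne_zero g _
      sq_phi := fun τ => by
        have h := denom_mul_of_pos (g := g.mat) (inv_det_pos g) τ
        rw [mul_inv_cancel, denom_one] at h
        rw [inv_pow, g.sq_phi]
        exact (eq_inv_of_mul_eq_one_right h.symm).symm }

@[simp] theorem mul_mat (g h : Metaplectic) : (g * h).mat = g.mat * h.mat := rfl
@[simp] theorem mul_phi (g h : Metaplectic) (τ : ℍ) :
    (g * h).phi τ = g.phi (h.mat • τ) * h.phi τ := rfl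
@[simp] theorem one_mat : (1 : Metaplectic).mat = 1 := rfl
@[simp] theorem one_phi (τ : ℍ) : (1 : Metaplectic).phi τ = 1 := rfl
@[simp] theorem inv_mat (g : Metaplectic) : (g⁻¹).mat = g.mat⁻¹ := rfl
@[simp] theorem inv_phi (g : Metaplectic) (τ : ℍ) :
    (g⁻¹).phi τ = (g.phi (g.mat⁻¹ • τ))⁻¹ := rfl

instance : Group Metaplectic :=
  Group.ofLeftAxioms
    (fun a b c => by
      ext1
      · simp [mul_assoc]
      · funext τ; simp [mul_smul, mul_assoc])
    (fun a => by
      ext1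
      · simp
      · funext τ; simp)
    (fun a => by
      ext1
      · simp
      · funext τ
        simp [phi_ne_zero])

/-- The covering map `(M, φ) ↦ M`. -/
def toGL : Metaplectic →* GL (Fin 2) ℝ where
  toFun := mat
  map_one' := rfl
  map_mul' _ _ := rfl

theorem mapGL_S : (Matrix.SpecialLinearGroup.mapGL ℝ ModularGroup.S : GL (Fin 2) ℝ).val =
    !![0, -1; 1, 0] := by
  ext i j
  change ((ModularGroup.S i j : ℤ) : ℝ) = _
  fin_cases i <;> fin_cases j <;> simp [ModularGroup.S]

theorem mapGL_T : (Matrix.SpecialLinearGroup.mapGL ℝ ModularGroup.T : GL (Fin 2) ℝ).val =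
    !![1, 1; 0, 1] := by
  ext i j
  change ((ModularGroup.T i j : ℤ) : ℝ) = _
  fin_cases i <;> fin_cases j <;> simp [ModularGroup.T]

theorem holo_sqrt : MDifferentiable 𝓘(ℂ) 𝓘(ℂ) (fun τ : ℍ => (τ : ℂ) ^ (1 / 2 : ℂ)) := by
  rw [UpperHalfPlane.mdifferentiable_iff]
  intro z hz
  have h : DifferentiableAt ℂ (fun w : ℂ => w ^ (1 / 2 : ℂ)) z :=
    (differentiableAt_id).cpow_const (Or.inr (ne_of_gt hz))
  refine h.differentiableWithinAt.congr (fun w hw => ?_) ?_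
  · simp [UpperHalfPlane.ofComplex_apply_of_im_pos hw]
  · simp [UpperHalfPlane.ofComplex_apply_of_im_pos hz]

/-- The element `(!![0, -1; 1, 0], √τ)`, with the principal branch of the root. -/
def S : Metaplectic where
  mat := Matrix.SpecialLinearGroup.mapGL ℝ ModularGroup.S
  det_pos := by simp
  phi := fun τ => (τ : ℂ) ^ (1 / 2 : ℂ)
  holo := holo_sqrt
  sq_phi := fun τ => by
    rw [← Complex.cpow_nat_mul]
    simp [denom]

/-- The element `(!![1, 1; 0, 1], 1)`. -/
def T : Metaplectic where
  mat := Matrix.SpecialLinearGroup.mapGL ℝ ModularGroup.T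
  det_pos := by simp
  phi := fun _ => 1
  holo := mdifferentiable_const
  sq_phi := fun τ => by simp [denom]

theorem eq_or_of_mat_eq {g h : Metaplectic} (e : g.mat = h.mat) :
    (∀ τ, g.phi τ = h.phi τ) ∨ (∀ τ, g.phi τ = - h.phi τ) := by
  have := (isPreconnected_univ (α := ℍ)).eq_or_eq_neg_of_sq_eq
    (f := g.phi) (g := h.phi) g.holo.continuous.continuousOn h.holo.continuous.continuousOn
    (fun τ _ => by simp [g.sq_phi, h.sq_phi, e])
    (fun _ => h.phi_ne_zero _)
  rcases this with h1 | h1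
  · left; intro τ; exact h1 (Set.mem_univ τ)
  · right; intro τ; simpa using h1 (Set.mem_univ τ)

theorem eq_of_mat_eq {g h : Metaplectic} (e : g.mat = h.mat) (τ : ℍ)
    (hτ : g.phi τ = h.phi τ) : g = h := by
  ext1
  · exact e
  · rcases eq_or_of_mat_eq e with h1 | h1
    · funext τ; exact h1 τ
    · exfalso
      have h2 := h1 τ
      rw [hτ] at h2
      exact h.phi_ne_zero τ (self_eq_neg.mp h2)

theorem S_smul (τ : ℍ) : ((S.mat • τ : ℍ) : ℂ) = - (τ : ℂ)⁻¹ := by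
  rw [UpperHalfPlane.coe_smul_of_det_pos S.det_pos]
  simp [S, num, denom, div_eq_mul_inv]

theorem T_smul (τ : ℍ) : ((T.mat • τ : ℍ) : ℂ) = τ + 1 := by
  rw [UpperHalfPlane.coe_smul_of_det_pos T.det_pos]
  simp [T, num, denom]


theorem S_mat : (S.mat : Matrix (Fin 2) (Fin 2) ℝ) = !![0, -1; 1, 0] := mapGL_S

theorem T_mat : (T.mat : Matrix (Fin 2) (Fin 2) ℝ) = !![1, 1; 0, 1] := mapGL_T

theorem S_sq_mat : ((S ^ 2).mat : Matrix (Fin 2) (Fin 2) ℝ) = -1 := by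
  rw [pow_two, mul_mat, Units.val_mul, S_mat]
  ext i j
  fin_cases i <;> fin_cases j <;> simp

theorem S_pow_four_mat : (S ^ 4).mat = 1 := by
  apply Units.ext
  rw [show (4 : ℕ) = 2 * 2 from rfl, pow_mul, pow_two (S ^ 2), mul_mat, Units.val_mul, S_sq_mat]
  simp

theorem S_pow_four_phi (τ : ℍ) : (S ^ 4).phi τ = -1 := by
  have h1 : (S ^ 2).mat • τ = τ := by
    have : (S ^ 2).mat = -1 := Units.ext (by rw [S_sq_mat]; simp)
    rw [this, UpperHalfPlane.neg_smul, one_smul]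
  rw [show (4 : ℕ) = 2 * 2 from rfl, pow_mul, pow_two (S ^ 2), mul_phi, h1, ← pow_two, sq_phi]
  simp [denom, S_sq_mat]

theorem S_pow_eight : S ^ 8 = 1 := by
  have h : (S ^ 4).mat = 1 := S_pow_four_mat
  rw [show (8 : ℕ) = 4 * 2 from rfl, pow_mul, pow_two]
  ext1
  · simp [h]
  · funext τ
    simp [h, S_pow_four_phi]

theorem S_pow_four_ne : S ^ 4 ≠ 1 := by
  intro h
  have h1 := S_pow_four_phi UpperHalfPlane.I
  rw [h, one_phi] at h1
  norm_num at h1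

/-- The point `exp(2πi/3)`. -/
def rho : ℍ := ⟨Complex.exp (2 * Real.pi / 3 * Complex.I), by
  rw [show (2 * Real.pi / 3 * Complex.I : ℂ) = ((2 * Real.pi / 3 : ℝ) : ℂ) * Complex.I by push_cast; ring,
    Complex.exp_ofReal_mul_I_im]
  apply Real.sin_pos_of_pos_of_lt_pi <;> linarith [Real.pi_pos]⟩

theorem sqrt_exp (x : ℝ) (h0 : 0 < x) (h1 : x < Real.pi) :
    Complex.exp (x * Complex.I) ^ (1 / 2 : ℂ) = Complex.exp (((x / 2 : ℝ) : ℂ) * Complex.I) := by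
  rw [Complex.cpow_def_of_ne_zero (Complex.exp_ne_zero _), Complex.log_exp]
  · congr 1; push_cast; ring
  · simp; linarith
  · simp; linarith

theorem S_sq_eq : S ^ 2 = (S * T) ^ 3 := by
  have hr : ((rho : ℍ) : ℂ) = Complex.exp ((2 * Real.pi / 3 : ℝ) * Complex.I) := by
    simp [rho]
  have hr1 : (rho : ℂ) + 1 = Complex.exp ((Real.pi / 3 : ℝ) * Complex.I) := by
    rw [hr, Complex.exp_mul_I, Complex.exp_mul_I, ← Complex.ofReal_cos, ← Complex.ofReal_sin,
      ← Complex.ofReal_cos, ← Complex.ofReal_sin, Real.cos_pi_div_three, Real.sin_pi_div_three,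
      show 2 * Real.pi / 3 = Real.pi - Real.pi / 3 by ring, Real.cos_pi_sub, Real.sin_pi_sub,
      Real.cos_pi_div_three, Real.sin_pi_div_three]
    push_cast; ring
  have hneg : (-1 : ℂ) = Complex.exp ((Real.pi : ℝ) * Complex.I) := by
    rw [Complex.exp_pi_mul_I]
  have hSr : ((S.mat • rho : ℍ) : ℂ) = Complex.exp ((Real.pi / 3 : ℝ) * Complex.I) := by
    rw [S_smul, hr, ← Complex.exp_neg, ← neg_one_mul, hneg, ← Complex.exp_add]
    congr 1; push_cast; ring
  have hST : S.mat • T.mat • rho = rho := by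
    ext1
    rw [S_smul, T_smul, hr1, hr, ← Complex.exp_neg, ← neg_one_mul, hneg, ← Complex.exp_add]
    congr 1; push_cast; ring
  have hphiS : ∀ τ, S.phi τ = (τ : ℂ) ^ (1 / 2 : ℂ) := fun _ => rfl
  have hphiT : ∀ τ, T.phi τ = 1 := fun _ => rfl
  have hpi := Real.pi_pos
  refine eq_of_mat_eq (Units.ext ?_) rho ?_
  · rw [S_sq_mat, pow_succ, pow_two]
    simp only [mul_mat, Units.val_mul, S_mat, T_mat]
    ext i j
    fin_cases i <;> fin_cases j <;> simp
  · rw [pow_succ (S * T), pow_two, pow_two]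
    simp only [mul_mat, mul_phi, mul_smul, hphiS, hphiT, hST, mul_one]
    rw [T_smul, hr1, hSr, hr, sqrt_exp _ (by linarith) (by linarith),
      sqrt_exp _ (by linarith) (by linarith), ← Complex.exp_add, ← Complex.exp_add,
      ← Complex.exp_add]
    congr 1; push_cast; ring

theorem normal_form {H : Type*} [Group H] (a b : H) (h : a ^ 2 = (a * b) ^ 3) (w : H)
    (hw : w ∈ Subgroup.closure {a, b}) :
    ∃ (i j : ℤ) (m : H), m ∈ Submonoid.closure {b, b * a * b} ∧ w = a ^ i * m * a ^ j := by
  have hz : Commute (a ^ 2) b := by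
    have h1 : Commute (a ^ 2) (a * b) := by rw [h]; exact (Commute.refl _).pow_left 3
    have h2 : Commute (a ^ 2) a := (Commute.refl a).pow_left 2
    have h3 : Commute (a ^ 2) (a⁻¹ * (a * b)) := h2.inv_right.mul_right h1
    simpa using h3
  have hb : ∀ k : ℤ, Commute (a ^ (2 * k)) b := fun k => by
    rw [zpow_mul]; exact Commute.zpow_left (by exact_mod_cast hz) k
  have hc : ∀ k : ℤ, Commute (a ^ (2 * k)) (b * a * b) := fun k =>
    ((hb k).mul_right ((Commute.refl a).zpow_left _)).mul_right (hb k)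
  have key : b * a * b * a * b = a := by
    have : a * (b * a * b * a * b) = a * a := by
      rw [← pow_two, h, pow_succ, pow_two]; simp only [mul_assoc]
    exact mul_left_cancel this
  set M := Submonoid.closure {b, b * a * b} with hM
  have bM : b ∈ M := Submonoid.subset_closure (by simp)
  have cM : b * a * b ∈ M := Submonoid.subset_closure (by simp)
  let F : H → Prop := fun w => ∃ (i j : ℤ) (m : H), m ∈ M ∧ w = a ^ i * m * a ^ j
  have Fa : ∀ (k : ℤ) (w : H), F w → F (a ^ k * w) := by
    rintro k w ⟨i, j, m, hm, rfl⟩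
    exact ⟨k + i, j, m, hm, by rw [zpow_add]; simp only [mul_assoc]⟩
  have Fm : ∀ m ∈ M, ∀ j : ℤ, F (b * a * (m * a ^ j)) ∧ F (b * a * b * a * (m * a ^ j)) := by
    intro m hm j
    induction hm using Submonoid.closure_induction_left with
    | one => exact ⟨⟨0, 1 + j, b, bM, by rw [zpow_add]; simp [mul_assoc]⟩,
        ⟨0, 1 + j, b * a * b, cM, by rw [zpow_add]; simp [mul_assoc]⟩⟩
    | mul_left x hx y hy _ =>
      rcases hx with rfl | rfl
      · refine ⟨⟨0, j, x * a * x * y, mul_mem cM hy, by simp [mul_assoc]⟩,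
          ⟨1, j, y, hy, ?_⟩⟩
        calc _ = (x * a * x * a * x) * y * a ^ j := by simp only [mul_assoc]
          _ = _ := by rw [key, zpow_one]
      · refine ⟨⟨1, j, y, hy, ?_⟩, ⟨2, j, b * y, mul_mem bM hy, ?_⟩⟩
        · calc _ = (b * a * b * a * b) * y * a ^ j := by simp only [mul_assoc]
            _ = _ := by rw [key, zpow_one]
        · calc _ = (b * a * b * a * b) * a * b * y * a ^ j := by simp only [mul_assoc]
            _ = _ := by rw [key]; simp only [zpow_ofNat, pow_two, mul_assoc]
  have Fbc : ∀ w, F w → F (b * w) ∧ F (b * a * b * w) := by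
    rintro w ⟨i, j, m, hm, rfl⟩
    rcases Int.even_or_odd' i with ⟨l, rfl | rfl⟩
    · refine ⟨⟨2 * l, j, b * m, mul_mem bM hm, ?_⟩, ⟨2 * l, j, b * a * b * m, mul_mem cM hm, ?_⟩⟩
      · rw [← mul_assoc, ← mul_assoc, ← (hb l).eq]; simp only [mul_assoc]
      · rw [← mul_assoc, ← mul_assoc, ← (hc l).eq]; simp only [mul_assoc]
    · refine ⟨?_, ?_⟩
      · have := Fa (2 * l) _ (Fm m hm j).1
        convert this using 1
        rw [zpow_add, zpow_one]
        calc _ = b * a ^ (2 * l) * a * m * a ^ j := by simp only [mul_assoc]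
          _ = _ := by rw [← (hb l).eq]; simp only [mul_assoc]
      · have := Fa (2 * l) _ (Fm m hm j).2
        convert this using 1
        rw [zpow_add, zpow_one]
        calc _ = (b * a * b) * a ^ (2 * l) * a * m * a ^ j := by simp only [mul_assoc]
          _ = _ := by rw [← (hc l).eq]; simp only [mul_assoc]
  have binv : b⁻¹ = a⁻¹ * (b * a * b) * a := by
    have : b * a * b * a = a * b⁻¹ := by rw [eq_mul_inv_iff_mul_eq]; exact key
    rw [mul_assoc, this]; simp
  change F w
  induction hw using Subgroup.closure_induction_left with
  | one => exact ⟨0, 0, 1, one_mem _, by simp⟩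
  | mul_left x hx y _ ih =>
    rcases hx with rfl | rfl
    · simpa using Fa 1 _ ih
    · exact (Fbc _ ih).1
  | inv_mul_cancel x hx y _ ih =>
    rcases hx with rfl | rfl
    · simpa using Fa (-1) _ ih
    · have h1 := Fa (-1) _ (Fbc _ (Fa 1 _ ih)).2
      convert h1 using 1
      rw [binv]; simp [mul_assoc]

theorem fst_eq_one {G : Type*} [Group G] (s t : G) (h1 : s ^ 2 = (s * t) ^ 3) (h2 : s ^ 8 = 1)
    (w : Metaplectic × G) (hw : w ∈ Subgroup.closure {((S, s) : Metaplectic × G), (T, t)})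
    (hw1 : w.1 = 1) : w = 1 := by
  obtain ⟨i, j, m, hm, rfl⟩ := normal_form (S, s) (T, t)
    (Prod.ext (by simpa using S_sq_eq) (by simpa using h1)) w hw
  have hm' : m = 1 ∨ ((∀ k l, 0 ≤ (m.1.mat : Matrix (Fin 2) (Fin 2) ℝ) k l) ∧
      3 ≤ ∑ k, ∑ l, (m.1.mat : Matrix (Fin 2) (Fin 2) ℝ) k l) := by
    clear hw1 hw
    induction hm using Submonoid.closure_induction_left with
    | one => exact Or.inl rfl
    | mul_left x hx y _ ih =>
      right
      rcases hx with rfl | rfl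
      · rcases ih with rfl | ⟨ih1, ih2⟩
        · simp [T_mat, Fin.forall_fin_two, Fin.sum_univ_two]; norm_num
        · have a1 := ih1 0 0
          have a2 := ih1 0 1
          have a3 := ih1 1 0
          have a4 := ih1 1 1
          simp only [Fin.sum_univ_two] at ih2
          simp [T_mat, Fin.forall_fin_two, Fin.sum_univ_two, Matrix.mul_apply]
          refine ⟨⟨⟨?_, ?_⟩, ?_, ?_⟩, ?_⟩ <;> linarith
      · rcases ih with rfl | ⟨ih1, ih2⟩
        · simp [T_mat, S_mat, Fin.forall_fin_two, Fin.sum_univ_two]; norm_num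
        · have a1 := ih1 0 0
          have a2 := ih1 0 1
          have a3 := ih1 1 0
          have a4 := ih1 1 1
          simp only [Fin.sum_univ_two] at ih2
          simp [T_mat, S_mat, Fin.forall_fin_two, Fin.sum_univ_two, Matrix.mul_apply]
          refine ⟨⟨⟨?_, ?_⟩, ?_, ?_⟩, ?_⟩ <;> linarith
  have hmS : m.1 = S ^ (-(i + j)) := by
    have : S ^ i * m.1 * S ^ j = 1 := by simpa using hw1
    rw [neg_add_rev, zpow_add, zpow_neg, zpow_neg]
    rw [mul_eq_one_iff_eq_inv] at this
    rw [← zpow_neg, ← zpow_neg]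
    rw [← zpow_neg] at this
    have h3 : m.1 = S ^ (-i) * S ^ (-j) := by rw [← this]; simp
    rw [h3, ← zpow_add, ← zpow_add, add_comm]
  have hpow : ∀ k : ℤ, ∑ u, ∑ v, ((S ^ k).mat : Matrix (Fin 2) (Fin 2) ℝ) u v ≤ 2 := by
    intro k
    have h4 : ∀ n : ℤ, (S ^ (4 * n)).mat = 1 := fun n => by
      change toGL (S ^ (4 * n)) = 1
      rw [zpow_mul, map_zpow]
      have : toGL (S ^ (4 : ℤ)) = 1 := by exact_mod_cast S_pow_four_mat
      rw [this, one_zpow]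
    have hk := Int.emod_add_mul_ediv k 4
    rw [← hk, zpow_add, mul_mat, h4, mul_one]
    have := Int.emod_nonneg k (show (4 : ℤ) ≠ 0 by norm_num)
    have := Int.emod_lt_of_pos k (show (0 : ℤ) < 4 by norm_num)
    interval_cases k % 4
    · simp [Matrix.one_apply]
    · simp [Fin.sum_univ_two, S_mat]
    · rw [zpow_ofNat, S_sq_mat]; simp [Matrix.one_apply]
    · rw [show (3 : ℤ) = 2 + 1 from rfl, zpow_add, zpow_one, mul_mat, Units.val_mul, zpow_ofNat,
        S_sq_mat, S_mat]
      simp [Fin.sum_univ_two]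
  have hm1 : m = 1 := by
    rcases hm' with h | ⟨_, h⟩
    · exact h
    · have := hpow (-(i + j))
      rw [← hmS] at this
      linarith
  subst hm1
  rw [mul_one, ← zpow_add]
  have hord : orderOf S = 2 ^ (2 + 1) :=
    orderOf_eq_prime_pow S_pow_four_ne S_pow_eight
  have h5 : S ^ (-(i + j)) = 1 := by rw [← hmS]; rfl
  rw [zpow_neg, inv_eq_one] at h5
  have hd := orderOf_dvd_iff_zpow_eq_one.mpr h5
  rw [hord] at hd
  obtain ⟨c, hc⟩ := hd
  rw [hc, zpow_mul]
  have : ((S, s) : Metaplectic × G) ^ (((2 ^ (2 + 1) : ℕ) : ℤ)) = 1 := by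
    rw [zpow_natCast]
    exact Prod.ext S_pow_eight h2
  rw [this, one_zpow]

/-- The metaplectic group `Mp₂(ℤ)`, the preimage of `SL₂(ℤ)`. -/
def integral : Subgroup Metaplectic :=
  (Matrix.SpecialLinearGroup.mapGL ℝ : SL(2, ℤ) →* GL (Fin 2) ℝ).range.comap toGL

theorem S_mem : S ∈ integral := ⟨ModularGroup.S, rfl⟩

theorem T_mem : T ∈ integral := ⟨ModularGroup.T, rfl⟩

theorem closure_S_T : Subgroup.closure {S, T} = integral := by
  apply le_antisymm
  · rw [Subgroup.closure_le]
    rintro x (rfl | rfl)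
    · exact S_mem
    · exact T_mem
  · rintro g ⟨γ, hγ⟩
    have h1 : ∀ γ : SL(2, ℤ), ∃ w ∈ Subgroup.closure {S, T}, Matrix.SpecialLinearGroup.mapGL ℝ γ = w.mat := by
      intro γ
      have hγ : γ ∈ Subgroup.closure {ModularGroup.S, ModularGroup.T} := by
        simp [SpecialLinearGroup.SL2Z_generators]
      induction hγ using Subgroup.closure_induction with
      | mem x hx =>
        rcases hx with rfl | rfl
        · exact ⟨S, Subgroup.subset_closure (by simp), rfl⟩
        · exact ⟨T, Subgroup.subset_closure (by simp), rfl⟩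
      | one => exact ⟨1, one_mem _, by simp⟩
      | mul x y _ _ hx hy =>
        obtain ⟨u, hu, hu'⟩ := hx
        obtain ⟨v, hv, hv'⟩ := hy
        exact ⟨u * v, mul_mem hu hv, by rw [map_mul, hu', hv']; rfl⟩
      | inv x _ hx =>
        obtain ⟨u, hu, hu'⟩ := hx
        exact ⟨u⁻¹, inv_mem hu, by rw [map_inv, hu']; rfl⟩
    obtain ⟨w, hw, hw'⟩ := h1 γ
    have e : g.mat = w.mat := by rw [← hw', hγ]; rfl
    rcases eq_or_of_mat_eq e with h | h
    · rw [eq_of_mat_eq e UpperHalfPlane.I (h _)]; exact hw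
    · have : g = S ^ 4 * w := by
        refine eq_of_mat_eq (by rw [mul_mat, S_pow_four_mat, one_mul, e]) UpperHalfPlane.I ?_
        rw [mul_phi, S_pow_four_phi, h]; ring
      rw [this]
      exact mul_mem (pow_mem (Subgroup.subset_closure (by simp)) 4) hw

theorem exists_hom {G : Type*} [Group G] (s t : G) (h1 : s ^ 2 = (s * t) ^ 3) (h2 : s ^ 8 = 1) :
    ∃ f : integral →* G, f ⟨S, S_mem⟩ = s ∧ f ⟨T, T_mem⟩ = t := by
  set W := Subgroup.closure {((S, s) : Metaplectic × G), (T, t)} with hW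
  have hsurj : ∀ g ∈ integral, ∃ x : G, (g, x) ∈ W := by
    intro g hg
    rw [← closure_S_T] at hg
    induction hg using Subgroup.closure_induction with
    | mem x hx =>
      rcases hx with rfl | rfl
      · exact ⟨s, Subgroup.subset_closure (by simp)⟩
      · exact ⟨t, Subgroup.subset_closure (by simp)⟩
    | one => exact ⟨1, one_mem W⟩
    | mul x y _ _ hx hy =>
      obtain ⟨u, hu⟩ := hx
      obtain ⟨v, hv⟩ := hy
      exact ⟨u * v, mul_mem hu hv⟩
    | inv x _ hx =>
      obtain ⟨u, hu⟩ := hx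
      exact ⟨u⁻¹, inv_mem hu⟩
  have huniq : ∀ (g : Metaplectic) (x y : G), (g, x) ∈ W → (g, y) ∈ W → x = y := by
    intro g x y hx hy
    have := fst_eq_one s t h1 h2 ((g, x) * (g, y)⁻¹) (mul_mem hx (inv_mem hy)) (by simp)
    have h3 := congrArg Prod.snd this
    simpa [mul_inv_eq_one] using h3
  choose f hf using hsurj
  refine ⟨MonoidHom.mk' (fun g => f g.1 g.2) fun a b => ?_, ?_, ?_⟩
  · exact huniq _ _ _ (hf _ (a * b).2) (mul_mem (hf _ a.2) (hf _ b.2))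
  · exact huniq _ _ _ (hf _ S_mem) (Subgroup.subset_closure (by simp))
  · exact huniq _ _ _ (hf _ T_mem) (Subgroup.subset_closure (by simp))

theorem hom_ext {G : Type*} [Group G] {f g : integral →* G}
    (hS : f ⟨S, S_mem⟩ = g ⟨S, S_mem⟩) (hT : f ⟨T, T_mem⟩ = g ⟨T, T_mem⟩) : f = g := by
  have key : ∀ x (hx : x ∈ Subgroup.closure {S, T}) (hx' : x ∈ integral),
      f ⟨x, hx'⟩ = g ⟨x, hx'⟩ := by
    intro x hx
    induction hx using Subgroup.closure_induction with
    | mem x hx =>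
      intro _
      rcases hx with rfl | rfl
      · exact hS
      · exact hT
    | one => intro h; exact (map_one f).trans (map_one g).symm
    | mul x y hx hy ihx ihy =>
      intro _
      rw [closure_S_T] at hx hy
      have h1 := congrArg₂ (· * ·) (ihx hx) (ihy hy)
      simp only [← map_mul] at h1
      exact h1
    | inv x hx ih =>
      intro _
      rw [closure_S_T] at hx
      have h1 := congrArg (·⁻¹) (ih hx)
      simp only [← map_inv] at h1
      exact h1
  ext ⟨x, hx⟩
  exact key x (by rw [closure_S_T]; exact hx) hx

end

end Metaplectic

/-- A discriminant form: a nondegenerate `ℚ/ℤ`-valued quadratic form `q(x) = x²/2` on an abelian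
group `A` (which is assumed finite wherever this is used). The bilinear form `(x, y)` is the polar
form `q(x + y) - q(x) - q(y)`. -/
structure DiscriminantForm (A : Type*) [AddCommGroup A] where
  q : QuadraticMap ℤ A (AddCircle (1 : ℚ))
  nondegenerate : ∀ x, (∀ y, QuadraticMap.polar q x y = 0) → x = 0

namespace DiscriminantForm

open scoped MatrixGroups UpperHalfPlane Manifold
open UpperHalfPlane

noncomputable section

theorem periodic_exp :
    Function.Periodic (fun x : ℚ => Complex.exp (2 * Real.pi * Complex.I * x)) 1 := by
  intro x
  change Complex.exp _ = Complex.exp _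
  rw [Complex.exp_eq_exp_iff_exists_int]
  exact ⟨1, by push_cast; ring⟩

/-- The character `e(x) = exp(2πix)` of `ℚ/ℤ`. -/
def e : AddChar (AddCircle (1 : ℚ)) ℂ where
  toFun := periodic_exp.lift
  map_zero_eq_one' := by
    change Complex.exp (2 * Real.pi * Complex.I * ((0 : ℚ) : ℂ)) = 1
    simp
  map_add_eq_mul' := by
    intro x y
    induction x using QuotientAddGroup.induction_on with | H x
    induction y using QuotientAddGroup.induction_on with | H y
    change Complex.exp (2 * Real.pi * Complex.I * ((x + y : ℚ) : ℂ)) =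
      Complex.exp (2 * Real.pi * Complex.I * (x : ℂ)) *
        Complex.exp (2 * Real.pi * Complex.I * (y : ℂ))
    rw [← Complex.exp_add]; congr 1; push_cast; ring

theorem e_coe (x : ℚ) : e (x : AddCircle (1 : ℚ)) = Complex.exp (2 * Real.pi * Complex.I * x) := rfl

theorem e_eq_one {x : AddCircle (1 : ℚ)} (h : e x = 1) : x = 0 := by
  induction x using QuotientAddGroup.induction_on with | H x
  rw [e_coe, Complex.exp_eq_one_iff] at h
  obtain ⟨n, hn⟩ := h
  rw [AddCircle.coe_eq_zero_iff]
  refine ⟨n, ?_⟩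
  have h2 : (2 * Real.pi * Complex.I : ℂ) ≠ 0 := Complex.two_pi_I_ne_zero
  have : (x : ℂ) = n := by
    apply mul_left_cancel₀ h2; rw [hn]; ring
  have : x = n := by exact_mod_cast this
  simp [this]

theorem conj_e (x : AddCircle (1 : ℚ)) : (starRingEnd ℂ) (e x) = e (-x) := by
  induction x using QuotientAddGroup.induction_on with | H x
  rw [← AddCircle.coe_neg, e_coe, e_coe, ← Complex.exp_conj]
  congr 1
  simp [Complex.conj_ofNat]

theorem e_mul_e_neg (x : AddCircle (1 : ℚ)) : e x * e (-x) = 1 := by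
  rw [← AddChar.map_add_eq_mul]; simp


variable {A : Type*} [AddCommGroup A] (D : DiscriminantForm A)

/-- The bilinear form `(x, y)`. -/
def b (x y : A) : AddCircle (1 : ℚ) := QuadraticMap.polar D.q x y

theorem q_add (x y : A) : D.q (x + y) = D.q x + D.q y + D.b x y := QuadraticMap.map_add D.q x y

theorem b_comm (x y : A) : D.b x y = D.b y x := QuadraticMap.polar_comm D.q x y
theorem b_add_left (x y z : A) : D.b (x + y) z = D.b x z + D.b y z :=
  QuadraticMap.polar_add_left D.q x y z
theorem b_add_right (x y z : A) : D.b x (y + z) = D.b x y + D.b x z :=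
  QuadraticMap.polar_add_right D.q x y z
theorem b_neg_left (x y : A) : D.b (-x) y = - D.b x y := QuadraticMap.polar_neg_left D.q x y
theorem b_zero_left (x : A) : D.b 0 x = 0 := QuadraticMap.polar_zero_left D.q x
theorem b_smul_left (n : ℤ) (x y : A) : D.b (n • x) y = n • D.b x y :=
  QuadraticMap.polar_smul_left D.q n x y
theorem b_smul_right (n : ℤ) (x y : A) : D.b x (n • y) = n • D.b x y :=
  QuadraticMap.polar_smul_right D.q n x y
theorem q_smul (n : ℤ) (x : A) : D.q (n • x) = (n * n) • D.q x := QuadraticMap.map_smul D.q n x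
theorem q_neg (x : A) : D.q (-x) = D.q x := QuadraticMap.map_neg D.q x

theorem q_lin (a b c d : ℤ) (x y z w : A) :
    D.q (a • x + b • y + c • z + d • w) =
      (a * a) • D.q x + (b * b) • D.q y + (c * c) • D.q z + (d * d) • D.q w
      + (a * b) • D.b x y + (a * c) • D.b x z + (a * d) • D.b x w
      + (b * c) • D.b y z + (b * d) • D.b y w + (c * d) • D.b z w := by
  simp only [q_add, b_add_left, q_smul, b_smul_left, b_smul_right, smul_add]
  module

theorem q_quaternion (a b c d : ℤ) (x y z w : A) :
    D.q (a • x + (-b) • y + (-c) • z + (-d) • w) + D.q (b • x + a • y + (-d) • z + c • w)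
      + D.q (c • x + d • y + a • z + (-b) • w) + D.q (d • x + (-c) • y + b • z + a • w) =
    (a * a + b * b + c * c + d * d) • (D.q x + D.q y + D.q z + D.q w) := by
  simp only [q_lin]
  module

/-- left multiplication by a quaternion on `A⁴` -/
def quat (a b c d : ℤ) : A × A × A × A → A × A × A × A := fun v =>
  (a • v.1 + (-b) • v.2.1 + (-c) • v.2.2.1 + (-d) • v.2.2.2,
   b • v.1 + a • v.2.1 + (-d) • v.2.2.1 + c • v.2.2.2,
   c • v.1 + d • v.2.1 + a • v.2.2.1 + (-b) • v.2.2.2,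
   d • v.1 + (-c) • v.2.1 + b • v.2.2.1 + a • v.2.2.2)

theorem quat_quat (a b c d : ℤ) (v : A × A × A × A) :
    quat a (-b) (-c) (-d) (quat a b c d v) = (a * a + b * b + c * c + d * d) • v := by
  obtain ⟨x, y, z, w⟩ := v
  simp only [quat, Prod.smul_mk, Prod.mk.injEq]
  refine ⟨?_, ?_, ?_, ?_⟩ <;> module

theorem sqrt_card_sq {A : Type*} [Fintype A] :
    ((Real.sqrt (Fintype.card A) : ℝ) : ℂ) ^ 2 = Fintype.card A := by
  rw [← Complex.ofReal_pow, Real.sq_sqrt (Nat.cast_nonneg _)]; simp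

variable [Fintype A]


theorem sum_e_b_zero : ∑ y, e (D.b 0 y) = (Fintype.card A : ℂ) := by
  simp [b_zero_left]

theorem sum_e_b_ne {x : A} (h : x ≠ 0) : ∑ y, e (D.b x y) = 0 := by
  let ψ : AddChar A ℂ :=
    { toFun := fun y => e (D.b x y)
      map_zero_eq_one' := by rw [b_comm, b_zero_left]; simp
      map_add_eq_mul' := fun y z => by rw [b_add_right, AddChar.map_add_eq_mul] }
  have : ∑ y, ψ y = 0 := by
    rw [AddChar.sum_eq_zero_iff_ne_zero]
    intro h0
    apply h
    apply D.nondegenerate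
    intro y
    apply e_eq_one
    exact DFunLike.congr_fun h0 y
  exact this

/-- The Gauss sum `g_d(A) = ∑ e(d x²/2)`. -/
def gaussSum (d : ℕ) : ℂ := ∑ x : A, e (d • D.q x)

theorem gaussSum_one : D.gaussSum 1 = ∑ x : A, e (D.q x) := by simp [gaussSum]

theorem gaussSum_mul_conj :
    (D.gaussSum 1) * (starRingEnd ℂ) (D.gaussSum 1) = Fintype.card A := by
  have h1 : ∀ y : A, (∑ x, e (D.q x)) * e (-D.q y) = ∑ u, e (D.q u) * e (D.b u y) := by
    intro y
    rw [Finset.sum_mul, ← Equiv.sum_comp (Equiv.addRight y)]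
    refine Finset.sum_congr rfl fun u _ => ?_
    rw [← AddChar.map_add_eq_mul, ← AddChar.map_add_eq_mul, Equiv.coe_addRight, q_add]
    congr 1; abel
  rw [gaussSum_one, map_sum, Finset.mul_sum]
  simp only [conj_e, h1]
  rw [Finset.sum_comm]
  simp only [← Finset.mul_sum]
  rw [Finset.sum_eq_single 0]
  · simp [b_zero_left]
  · intro u _ hu
    rw [sum_e_b_ne D hu, mul_zero]
  · simp

theorem card_smul (x : A) : (Fintype.card A : ℤ) • x = 0 := by simp

theorem card_sq_smul_q (x : A) : ((Fintype.card A : ℤ) * Fintype.card A) • D.q x = 0 := by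
  rw [← q_smul, card_smul, QuadraticMap.map_zero]

theorem gaussSum_pow_four :
    (D.gaussSum 1) ^ 4 = (starRingEnd ℂ) (D.gaussSum 1) ^ 4 := by
  have h4 : ∀ f : A → ℂ, (∑ x, f x) ^ 4 =
      ∑ v : A × A × A × A, f v.1 * (f v.2.1 * (f v.2.2.1 * f v.2.2.2)) := by
    intro f
    simp only [Fintype.sum_prod_type, ← Finset.mul_sum, ← Finset.sum_mul]
    ring
  have hpos : 1 ≤ Fintype.card A := Fintype.card_pos
  obtain ⟨a, b, c, d, h⟩ := Nat.sum_four_squares (Fintype.card A * Fintype.card A - 1)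
  have h' : (a * a + b * b + c * c + d * d : ℤ) = Fintype.card A * Fintype.card A - 1 := by
    have h1 : 1 ≤ Fintype.card A * Fintype.card A := Nat.one_le_iff_ne_zero.mpr (by positivity)
    zify [h1] at h
    rw [← h]; ring
  have hA : ∀ x : A, (a * a + b * b + c * c + d * d : ℤ) • x = -x := by
    intro x; rw [h', sub_smul, mul_smul, card_smul]; simp
  have hq : ∀ x : A, (a * a + b * b + c * c + d * d : ℤ) • D.q x = -D.q x := by
    intro x; rw [h', sub_smul, card_sq_smul_q]; simp
  have hinj : Function.Injective (quat (A := A) a b c d) := by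
    intro v w hvw
    have := congrArg (quat a (-b) (-c) (-d)) hvw
    rw [quat_quat, quat_quat] at this
    obtain ⟨v1, v2, v3, v4⟩ := v
    obtain ⟨w1, w2, w3, w4⟩ := w
    simpa [hA] using this
  rw [gaussSum_one, map_sum, h4, h4]
  simp only [conj_e, ← AddChar.map_add_eq_mul]
  refine (Fintype.sum_bijective _ hinj.bijective_of_finite _ _ fun v => ?_).symm
  obtain ⟨x, y, z, w⟩ := v
  congr 1
  have := D.q_quaternion a b c d x y z w
  simp only [smul_add, hq] at this
  simp only [quat]
  rw [← add_assoc, ← add_assoc, ← add_assoc, ← add_assoc, this]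

theorem exists_signature : ∃ s : ZMod 8, D.gaussSum 1 =
    (Real.sqrt (Fintype.card A) : ℂ) * e (((s.val : ℚ) / 8 : ℚ) : AddCircle (1 : ℚ)) := by
  have hc : (0 : ℝ) < Fintype.card A := by exact_mod_cast Fintype.card_pos
  set r : ℂ := (Real.sqrt (Fintype.card A) : ℂ) with hr
  have hr2 : r ^ 2 = Fintype.card A := by
    rw [hr, ← Complex.ofReal_pow, Real.sq_sqrt hc.le]; simp
  have hr0 : r ≠ 0 := by
    intro h; rw [h] at hr2
    have : (Fintype.card A : ℂ) ≠ 0 := by exact_mod_cast Fintype.card_ne_zero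
    exact this (by rw [← hr2]; simp)
  have h8 : (D.gaussSum 1 / r) ^ 8 = 1 := by
    rw [div_pow, div_eq_one_iff_eq (pow_ne_zero _ hr0)]
    calc D.gaussSum 1 ^ 8 = D.gaussSum 1 ^ 4 * D.gaussSum 1 ^ 4 := by ring
      _ = (D.gaussSum 1 * (starRingEnd ℂ) (D.gaussSum 1)) ^ 4 := by
        nth_rewrite 2 [gaussSum_pow_four]; ring
      _ = r ^ 8 := by rw [gaussSum_mul_conj, ← hr2]; ring
  obtain ⟨i, hi, hi'⟩ := (Complex.isPrimitiveRoot_exp 8 (by norm_num)).eq_pow_of_pow_eq_one h8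
  refine ⟨(i : ZMod 8), ?_⟩
  rw [ZMod.val_natCast_of_lt hi, eq_comm, mul_comm, ← eq_div_iff hr0, ← hi', e_coe,
    ← Complex.exp_nat_mul]
  congr 1; push_cast; ring

theorem signature_unique (s t : ZMod 8)
    (h : e (((s.val : ℚ) / 8 : ℚ) : AddCircle (1 : ℚ)) =
      e (((t.val : ℚ) / 8 : ℚ) : AddCircle (1 : ℚ))) : s = t := by
  have h1 : e ((((s.val : ℚ) / 8 : ℚ) : AddCircle (1 : ℚ)) +
      -(((t.val : ℚ) / 8 : ℚ) : AddCircle (1 : ℚ))) = 1 := by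
    rw [AddChar.map_add_eq_mul, h, e_mul_e_neg]
  have h2 := e_eq_one h1
  rw [← AddCircle.coe_neg, ← AddCircle.coe_add, AddCircle.coe_eq_zero_iff] at h2
  obtain ⟨n, hn⟩ := h2
  have hs := ZMod.val_lt s
  have ht := ZMod.val_lt t
  have h3 : (8 : ℤ) * n = s.val - t.val := by
    have : (8 : ℚ) * n = s.val - t.val := by
      simp only [zsmul_eq_mul, mul_one] at hn
      linarith
    exact_mod_cast this
  have h4 : s.val = t.val := by omega
  exact ZMod.val_injective 8 h4

/-- The signature `sig(A) ∈ ℤ/8ℤ`: the residue class determined by Milgram's formula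
`∑ e(x²/2) = √|A| · e(sig(A)/8)`. -/
def signature : ZMod 8 := D.exists_signature.choose

theorem milgram : ∑ x : A, e (D.q x) =
    (Real.sqrt (Fintype.card A) : ℂ) *
      e (((D.signature.val : ℚ) / 8 : ℚ) : AddCircle (1 : ℚ)) := by
  rw [← gaussSum_one]; exact D.exists_signature.choose_spec

/-- The constant `e(-sig(A)/8) / √|A|`. -/
def weilConst : ℂ :=
  e ((-(D.signature.val : ℚ) / 8 : ℚ) : AddCircle (1 : ℚ)) / (Real.sqrt (Fintype.card A) : ℂ)

theorem card_ne : (Fintype.card A : ℂ) ≠ 0 := by exact_mod_cast Fintype.card_ne_zero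

theorem sqrt_card_ne : ((Real.sqrt (Fintype.card A) : ℝ) : ℂ) ≠ 0 := by
  intro h
  have := sqrt_card_sq (A := A)
  rw [h] at this
  exact card_ne (A := A) (by rw [← this]; simp)

theorem weilConst_mul_sum : D.weilConst * ∑ x : A, e (D.q x) = 1 := by
  have h := sqrt_card_ne (A := A)
  rw [milgram, weilConst, neg_div, AddCircle.coe_neg]
  field_simp
  rw [mul_comm, e_mul_e_neg]

theorem conj_weilConst_mul : (starRingEnd ℂ) D.weilConst * D.weilConst * Fintype.card A = 1 := by
  have h := sqrt_card_ne (A := A)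
  rw [weilConst, map_div₀, conj_e, Complex.conj_ofReal, ← sqrt_card_sq]
  field_simp
  rw [mul_comm, e_mul_e_neg]

theorem weilConst_pow : (D.weilConst ^ 2 * Fintype.card A) ^ 4 = 1 := by
  have h := sqrt_card_ne (A := A)
  rw [weilConst, ← sqrt_card_sq, div_pow, div_mul_cancel₀ _ (pow_ne_zero 2 h), ← pow_mul,
    e_coe, ← Complex.exp_nat_mul, Complex.exp_eq_one_iff]
  refine ⟨-(D.signature.val : ℤ), ?_⟩
  push_cast; ring

variable [DecidableEq A]

/-- The matrix of `e_x ↦ e(x²/2) e_x`. -/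
def weilT : Matrix A A ℂ := Matrix.diagonal fun x => e (D.q x)

/-- The matrix of `e_x ↦ e(-sig(A)/8) / √|A| · ∑_y e(-(x, y)) e_y`. -/
def weilS : Matrix A A ℂ := Matrix.of fun y x => D.weilConst * e (-D.b x y)

theorem weilT_mem : D.weilT ∈ Matrix.unitaryGroup A ℂ := by
  rw [Matrix.mem_unitaryGroup_iff']
  rw [weilT, Matrix.star_eq_conjTranspose, Matrix.diagonal_conjTranspose,
    Matrix.diagonal_mul_diagonal, ← Matrix.diagonal_one]
  congr 1
  funext x
  change (starRingEnd ℂ) (e (D.q x)) * e (D.q x) = 1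
  rw [conj_e, mul_comm, e_mul_e_neg]

theorem weilS_mem : D.weilS ∈ Matrix.unitaryGroup A ℂ := by
  rw [Matrix.mem_unitaryGroup_iff']
  ext y x
  rw [Matrix.mul_apply, Matrix.one_apply]
  have h : ∀ z, star D.weilS y z * D.weilS z x =
      (starRingEnd ℂ) D.weilConst * D.weilConst * e (D.b (y - x) z) := by
    intro z
    change (starRingEnd ℂ) (D.weilConst * e (-D.b y z)) * (D.weilConst * e (-D.b x z)) = _
    rw [map_mul, conj_e, sub_eq_add_neg, b_add_left, b_neg_left, AddChar.map_add_eq_mul, neg_neg]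
    ring
  simp only [h, ← Finset.mul_sum]
  split_ifs with hxy
  · rw [hxy, sub_self, sum_e_b_zero, conj_weilConst_mul]
  · rw [sum_e_b_ne D (sub_ne_zero.mpr hxy), mul_zero]

/-- `weilT` as a unitary matrix. -/
def weilTU : Matrix.unitaryGroup A ℂ := ⟨D.weilT, D.weilT_mem⟩

/-- `weilS` as a unitary matrix. -/
def weilSU : Matrix.unitaryGroup A ℂ := ⟨D.weilS, D.weilS_mem⟩

theorem weilS_sq (y x : A) :
    (D.weilS * D.weilS) y x = if y = -x then D.weilConst ^ 2 * Fintype.card A else 0 := by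
  rw [Matrix.mul_apply]
  have h : ∀ z, D.weilS y z * D.weilS z x = D.weilConst ^ 2 * e (D.b (-(y + x)) z) := by
    intro z
    change (D.weilConst * e (-D.b z y)) * (D.weilConst * e (-D.b x z)) = _
    rw [b_neg_left, b_add_left, neg_add, AddChar.map_add_eq_mul, D.b_comm z y]
    ring
  simp only [h, ← Finset.mul_sum]
  split_ifs with hxy
  · rw [hxy]; simp [b_zero_left]
  · rw [sum_e_b_ne D, mul_zero]
    rwa [neg_ne_zero, ← sub_neg_eq_add, sub_ne_zero]

theorem weilS_four :
    (D.weilS * D.weilS) * (D.weilS * D.weilS) =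
      (D.weilConst ^ 2 * Fintype.card A) ^ 2 • (1 : Matrix A A ℂ) := by
  ext y x
  rw [Matrix.mul_apply]
  simp only [weilS_sq]
  rw [Finset.sum_eq_single (-x)]
  · simp [Matrix.one_apply]; ring_nf
  · intro z _ hz
    simp [hz]
  · simp

theorem weilSU_pow_eight : D.weilSU ^ 8 = 1 := by
  apply Subtype.ext
  change D.weilS ^ 8 = 1
  have : D.weilS ^ 8 = ((D.weilS * D.weilS) * (D.weilS * D.weilS)) ^ 2 := by
    simp only [← pow_two, ← pow_mul]; norm_num
  rw [this, weilS_four, smul_pow, one_pow, ← pow_mul, weilConst_pow, one_smul]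

theorem weil_braid : D.weilT * (D.weilS * D.weilT * D.weilS) * D.weilT = D.weilS := by
  ext y x
  rw [weilT, Matrix.mul_diagonal, Matrix.diagonal_mul, Matrix.mul_apply]
  have h : ∀ z, (D.weilS * Matrix.diagonal fun x => e (D.q x)) y z * D.weilS z x =
      D.weilConst ^ 2 * e (-D.q (y + x)) * e (D.q (z + -(y + x))) := by
    intro z
    rw [Matrix.mul_diagonal]
    change (D.weilConst * e (-D.b z y)) * e (D.q z) * (D.weilConst * e (-D.b x z)) = _
    rw [D.q_add z, q_neg, D.b_comm z (-(y + x)), b_neg_left, b_add_left, D.b_comm z y]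
    have : e (-D.b y z) * e (D.q z) * e (-D.b x z) =
        e (-D.q (y + x)) * e (D.q z + D.q (y + x) + -(D.b y z + D.b x z)) := by
      simp only [← AddChar.map_add_eq_mul]
      congr 1; abel
    linear_combination D.weilConst ^ 2 * this
  simp only [h, ← Finset.mul_sum]
  have hs : ∑ z, e (D.q (z + -(y + x))) = ∑ z, e (D.q z) :=
    Equiv.sum_comp (Equiv.addRight (-(y + x))) (fun z => e (D.q z))
  rw [hs]
  change _ = D.weilConst * e (-D.b x y)
  have h2 : e (D.q y) * e (-D.q (y + x)) * e (D.q x) = e (-D.b x y) := by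
    simp only [← AddChar.map_add_eq_mul]
    rw [q_add, D.b_comm y x]
    congr 1; abel
  rw [← h2]
  linear_combination (D.weilConst * (e (D.q y) * e (-D.q (y + x)) * e (D.q x))) *
    D.weilConst_mul_sum

theorem weil_rel : D.weilSU ^ 2 = (D.weilSU * D.weilTU) ^ 3 := by
  apply Subtype.ext
  change D.weilS ^ 2 = (D.weilS * D.weilT) ^ 3
  rw [pow_succ (D.weilS * D.weilT), pow_two, pow_two]
  nth_rewrite 2 [← weil_braid]
  simp only [mul_assoc]

/-- The Weil representation of `Mp₂(ℤ)` on `ℂ[A]`, with unitary operators written as matrices in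
the standard basis `(e_x)`: the homomorphism with the prescribed values at `T` and `S`. -/
def weilRep : Metaplectic.integral →* Matrix.unitaryGroup A ℂ :=
  (Metaplectic.exists_hom D.weilSU D.weilTU D.weil_rel D.weilSU_pow_eight).choose

theorem weilRep_S : D.weilRep ⟨Metaplectic.S, Metaplectic.S_mem⟩ = D.weilSU :=
  (Metaplectic.exists_hom D.weilSU D.weilTU D.weil_rel D.weilSU_pow_eight).choose_spec.1

theorem weilRep_T : D.weilRep ⟨Metaplectic.T, Metaplectic.T_mem⟩ = D.weilTU :=
  (Metaplectic.exists_hom D.weilSU D.weilTU D.weil_rel D.weilSU_pow_eight).choose_spec.2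

theorem eq_weilRep (f : Metaplectic.integral →* Matrix.unitaryGroup A ℂ)
    (hS : f ⟨Metaplectic.S, Metaplectic.S_mem⟩ = D.weilSU)
    (hT : f ⟨Metaplectic.T, Metaplectic.T_mem⟩ = D.weilTU) : f = D.weilRep :=
  Metaplectic.hom_ext (hS.trans D.weilRep_S.symm) (hT.trans D.weilRep_T.symm)

end

section Level

variable {A : Type*} [AddCommGroup A] (D : DiscriminantForm A)

/-- The level: the smallest positive integer `N` with `N x²/2 = 0` in `ℚ/ℤ` for all `x`. -/
noncomputable def level : ℕ := sInf {n : ℕ | 0 < n ∧ ∀ x, n • D.q x = 0}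

theorem level_spec [Fintype A] : 0 < D.level ∧ ∀ x, D.level • D.q x = 0 := by
  apply Nat.sInf_mem (s := {n : ℕ | 0 < n ∧ ∀ x, n • D.q x = 0})
  refine ⟨Fintype.card A * Fintype.card A,
    Nat.mul_pos Fintype.card_pos Fintype.card_pos, fun x => ?_⟩
  have h := D.card_sq_smul_q x
  rw [← natCast_zsmul]
  exact_mod_cast h

end Level

noncomputable section

/-- `B` is the integral matrix `nM`, with `n` and `det B` prime to `N`. -/
def IsIntegralMultiple (N : ℕ) (M : GL (Fin 2) ℝ) (n : ℤ) (B : Matrix (Fin 2) (Fin 2) ℤ) : Prop :=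
  n ≠ 0 ∧ IsCoprime n (N : ℤ) ∧ IsCoprime B.det (N : ℤ) ∧
    (n : ℝ) • M.val = B.map (fun a : ℤ => (a : ℝ))

/-- The group `𝒢(N)`: matrices in `GL₂⁺(ℚ)` having an integral multiple `nM` with `n` and
`det(nM)` prime to `N`. -/
def groupG (N : ℕ) : Set (GL (Fin 2) ℝ) :=
  {M | 0 < M.det.val ∧ ∃ n B, IsIntegralMultiple N M n B}

/-- `R` is the reduction modulo `N` of `M ∈ 𝒢(N)`, i.e. `R = n⁻¹ · (nM mod N)`. -/
def ReducesTo (N : ℕ) (M : GL (Fin 2) ℝ) (R : Matrix (Fin 2) (Fin 2) (ZMod N)) : Prop :=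
  ∃ n B, IsIntegralMultiple N M n B ∧ (n : ZMod N) • R = B.map (fun a : ℤ => (a : ZMod N))

/-- `ℋ(N)`: the elements of `𝒢(N)` whose determinant is a square modulo `N`. -/
def groupH (N : ℕ) : Set (GL (Fin 2) ℝ) :=
  {M | M ∈ groupG N ∧ ∃ R, ReducesTo N M R ∧ IsSquare R.det}

/-- The preimage of `ℋ(N)` in the metaplectic cover. -/
def metaplecticH (N : ℕ) : Set Metaplectic := {α | α.mat ∈ groupH N}

variable {A : Type*} [AddCommGroup A] [Fintype A] [DecidableEq A] (D : DiscriminantForm A)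

/-- The class `ρ_A(M, r) ∈ U(ℂ[A]) / {±1}`, as a set of unitary matrices, for
`(M, r) ∈ 𝒬(N)`, i.e. `M ∈ 𝒢(N)`, `r ∈ U(N)`, `det M ≡ r² mod N`. Writing the reduction of `M` as
`r γ` with `γ ∈ SL₂(ℤ/N)` and choosing a preimage `g ∈ Mp₂(ℤ)` of `γ`, it is the class of
`g(A) / g_r(A) · ρ_A(g)`. (In odd signature this does not depend on `g`.) -/
def weilClass (M : GL (Fin 2) ℝ) (r : (ZMod D.level)ˣ) : Set (Matrix.unitaryGroup A ℂ) :=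
  {u | ∃ R, ReducesTo D.level M R ∧ R.det = (r : ZMod D.level) ^ 2 ∧
    ∃ (γ : SL(2, ℤ)) (g : Metaplectic.integral),
      g.1.mat = Matrix.SpecialLinearGroup.mapGL ℝ γ ∧
      R = (r : ZMod D.level) • γ.1.map (fun a : ℤ => (a : ZMod D.level)) ∧
      ∃ ε : ℂ, (ε = 1 ∨ ε = -1) ∧
        u.1 = (ε * (D.gaussSum 1 / D.gaussSum (r : ZMod D.level).val)) • (D.weilRep g).1}

/-- The product group in which `𝒬₂(N)` lives. -/
abbrev Ambient : Type _ := Metaplectic × (ZMod D.level)ˣ × Matrix.unitaryGroup A ℂ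

/-- The group `𝒬₂(N)`, in its description without cocycles: tuples `(M, φ, r, u)` with
`(M, φ)` in the metaplectic preimage of `ℋ(N)`, `r ∈ U(N)`, `det M ≡ r² mod N`, and `u` one of the
two unitary operators in the class `ρ_A(M, r) ∈ U(ℂ[A]) / {±1}`; the multiplication is
component-wise.
If representatives `ρ'(M, r) ∈ ρ_A(M, r)` are chosen, with `{±1}`-valued cocycle `c`, then
`(M, φ, r, t) ↦ (M, φ, r, t ρ'(M, r))` identifies the group of tuples with `t ∈ {±1}` and with
multiplication twisted by `c⁻¹` with this group; `u` is the operator by which the tuple acts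
on `ℂ[A]`. -/
def groupQ2 : Set D.Ambient :=
  {ξ | ξ.1 ∈ metaplecticH D.level ∧ ξ.2.2 ∈ D.weilClass ξ.1.mat ξ.2.1}

/-- The section `L(γ) = (γ, 1, ρ_A(γ))` over `Mp₂(ℤ)`. -/
def sectionL : Metaplectic.integral →* D.Ambient :=
  (Metaplectic.integral.subtype).prod ((1 : Metaplectic.integral →* (ZMod D.level)ˣ).prod D.weilRep)

/-- `Δ = L(Mp₂(ℤ))`. -/
def Delta : Subgroup D.Ambient := D.sectionL.range

/-- The right action of weight `k = κ/2`:
`f |_{k,A} (M, φ, r, u) (τ) = det(M)^{k/2} φ(τ)^{-2k} u⁻¹ f(Mτ)`. -/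
def slash (κ : ℤ) (ξ : D.Ambient) (f : ℍ → A → ℂ) : ℍ → A → ℂ := fun τ =>
  ((((ξ.1.mat.det.val : ℝ) ^ ((κ : ℝ) / 4) : ℝ) : ℂ) * ξ.1.phi τ ^ (-κ)) •
    (ξ.2.2⁻¹.1.mulVec (f (ξ.1.mat • τ)))

/-- The space `M_{k,A}` of modular forms of weight `k = κ/2` and type `ρ_A` for `Mp₂(ℤ)`: the
holomorphic `f : ℍ → ℂ[A]` with `f(Mτ) = φ(τ)^{2k} ρ_A(M, φ) f(τ)` which are holomorphic at `∞`
(i.e. bounded for `Im τ → ∞`). -/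
def modularForms (κ : ℤ) : Submodule ℂ (ℍ → A → ℂ) where
  carrier := {f | (∀ x, MDifferentiable 𝓘(ℂ) 𝓘(ℂ) fun τ => f τ x) ∧
    (∀ (g : Metaplectic.integral) (τ : ℍ),
      f (g.1.mat • τ) = g.1.phi τ ^ κ • (D.weilRep g).1.mulVec (f τ)) ∧
    ∀ x, IsBoundedAtImInfty fun τ => f τ x}
  add_mem' := by
    rintro f g ⟨hf1, hf2, hf3⟩ ⟨hg1, hg2, hg3⟩
    refine ⟨fun x => (hf1 x).add (hg1 x), fun γ τ => ?_, fun x => (hf3 x).add (hg3 x)⟩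
    rw [Pi.add_apply, Pi.add_apply, hf2, hg2, Matrix.mulVec_add, smul_add]
  zero_mem' := by
    refine ⟨fun x => mdifferentiable_const, fun γ τ => ?_, fun x => ?_⟩
    · simp
    · exact Filter.const_boundedAtFilter _ 0
  smul_mem' := by
    rintro c f ⟨hf1, hf2, hf3⟩
    refine ⟨fun x => (hf1 x).const_smul c, fun γ τ => ?_, fun x => ?_⟩
    · rw [Pi.smul_apply, Pi.smul_apply, hf2, Matrix.mulVec_smul, smul_comm]
    · exact (hf3 x).smul c

/-- The set `Δ \ ΔξΔ` of cosets `Δξ_i`. -/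
def heckeCosets (ξ : D.Ambient) : Set (Quotient (QuotientGroup.rightRel D.Delta)) :=
  (Quotient.mk _) '' DoubleCoset.doubleCoset ξ D.Delta D.Delta

/-- The Hecke operator `f |_{k,A} T(ξ) = det(ξ)^{k/2-1} ∑_i f |_{k,A} ξ_i`, where
`ΔξΔ = ⋃ Δξ_i` is a disjoint union and `k = κ/2`; the choice of the representatives `ξ_i` is
immaterial for `f ∈ M_{k,A}`. -/
def hecke (κ : ℤ) (ξ : D.Ambient) (f : ℍ → A → ℂ) : ℍ → A → ℂ :=
  (((ξ.1.mat.det.val : ℝ) ^ ((κ : ℝ) / 4 - 1) : ℝ) : ℂ) •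
    ∑ᶠ c ∈ D.heckeCosets ξ, D.slash κ c.out f

end

end DiscriminantForm

/-!
The Hecke operator is shown to vanish because `ΔξΔ` is stable under multiplication by a scalar
`ζ ≠ 1`: if `αg = g'α` with `g, g' ∈ Mp₂(ℤ)` and `uρ(g) = ζ ρ(g')u`, then multiplication by `ζ`
permutes the cosets `Δξᵢ`, so `T(ξ)f = ζ⁻¹ T(ξ)f` (`hecke_eq_zero`). Such a scalar exists for every
relation `αg = g'α`: the Weil representation normalises the Heisenberg group acting on `ℂ[A]`,
which acts irreducibly, and therefore elements congruent modulo `N` act by proportional operators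
(`weilRep_mul_heisenberg`, `exists_weilRep_eq_smul`), while `u` is a multiple of `ρ(g₀)` for some `g₀`
congruent modulo `N` to a multiple of the matrix of `α`. Taking determinants, `ζ` is a root of
unity of bounded order; together with the congruence subgroup of level `det` this bounds the
number of cosets (`heckeCosets_finite`).

It remains to find a relation with `ζ ≠ 1` when `det α` is not a rational square
(`exists_weilRep_mul_ne`). By elementary divisors the matrix of `α` may be taken to be a multiple of
`diag(m, 1)`, where `m` is a square modulo `N` but not in `ℤ`, and then `u` preserves the line of `e₀`
and its complement. In odd signature `4 ∣ N`: otherwise `-1` is a sum of two squares modulo `N`, which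
makes the square of the Gauss sum real. Hence `m ≡ 1 mod 4`, and quadratic reciprocity with
Dirichlet's theorem yields a prime `x ≡ -1 mod N` with `(m/x) = -1`, so that `xy = mᵏ + 1` for
`k = (x - 1)/2` and some `y`. Conjugation by `αᵏ` takes the lift `S Tˣ S Tʸ S` of `(-y, 1; mᵏ, -x)` to
`T⁻ʸ S T⁻ˣ` (`T_pow_mul_conj_mul_T_pow`). The entries at `(0, 0)` of the corresponding operators
are `w³ ḡ²` and `w`, where `g = ∑ e(x²/2)` and `w = g⁻¹`. If all the scalars along the way were equal
to `1`, these would agree and `g² = ḡ²`; but `g² = |A| e(sig/4)` is not real in odd signature.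
-/

/-! ### Elementary divisors of integral matrices of size two -/

namespace Matrix

open scoped MatrixGroups

/-- Elementary divisors in size two: every integral matrix of positive determinant is equivalent
under `SL₂(ℤ) × SL₂(ℤ)` to a matrix `diag(cm, c)`. -/
theorem exists_eq_SL_mul_diagonal_mul_SL {B : Matrix (Fin 2) (Fin 2) ℤ} (hB : 0 < B.det) :
    ∃ (γ₁ γ₂ : SL(2, ℤ)) (c m : ℤ), 0 < m ∧ c ≠ 0 ∧ B = γ₁.1 * !![c * m, 0; 0, c] * γ₂.1 := by
  let O : ℤ → ℤ → ℤ → ℤ → Prop := fun a b c d =>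
    ∃ γ₁ γ₂ : SL(2, ℤ), !![a, b; c, d] = γ₁.1 * B * γ₂.1
  have hO : ∀ a b c d, O a b c d → ∀ g h : Matrix (Fin 2) (Fin 2) ℤ, g.det = 1 → h.det = 1 →
      ∀ a' b' c' d', g * !![a, b; c, d] * h = !![a', b'; c', d'] → O a' b' c' d' := by
    rintro a b c d ⟨γ₁, γ₂, h⟩ g k hg hk a' b' c' d' e
    refine ⟨⟨g, hg⟩ * γ₁, γ₂ * ⟨k, hk⟩, ?_⟩
    rw [← e, h]
    change _ = (g * γ₁.1) * B * (γ₂.1 * k)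
    simp only [Matrix.mul_assoc]
  have addRow : ∀ a b c d k, O a b c d → O (a + k * c) (b + k * d) c d := fun a b c d k h =>
    hO _ _ _ _ h !![1, k; 0, 1] 1 (by simp [det_fin_two_of]) (by simp) _ _ _ _
      (by simp)
  have addCol : ∀ a b c d k, O a b c d → O (a + k * b) b (c + k * d) d := fun a b c d k h =>
    hO _ _ _ _ h 1 !![1, 0; k, 1] (by simp) (by simp [det_fin_two_of]) _ _ _ _
      (by simp [mul_comm])
  have addRow' : ∀ a b c d, O a b c d → O a b (c + a) (d + b) := fun a b c d h =>
    hO _ _ _ _ h !![1, 0; 1, 1] 1 (by simp [det_fin_two_of]) (by simp) _ _ _ _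
      (by simp [add_comm])
  have swapRow : ∀ a b c d, O a b c d → O (-c) (-d) a b := fun a b c d h =>
    hO _ _ _ _ h !![0, -1; 1, 0] 1 (by simp [det_fin_two_of]) (by simp) _ _ _ _
      (by simp)
  have swapCol : ∀ a b c d, O a b c d → O (-b) a (-d) c := fun a b c d h =>
    hO _ _ _ _ h 1 !![0, 1; -1, 0] (by simp) (by simp [det_fin_two_of]) _ _ _ _
      (by simp)
  -- Among all equivalent matrices, take one whose lower right entry is nonzero and as small as
  -- possible.
  have hex : ∃ n : ℕ, n ≠ 0 ∧ ∃ a b c d, O a b c d ∧ d.natAbs = n := by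
    have h0 : O (B 0 0) (B 0 1) (B 1 0) (B 1 1) := ⟨1, 1, by simpa using (eta_fin_two B).symm⟩
    by_contra! hn
    have key : ∀ a b c d, O a b c d → d = 0 := fun a b c d hX => by
      by_contra h
      exact hn _ (Int.natAbs_ne_zero.mpr h) a b c d hX rfl
    have h1 := key _ _ _ _ h0
    have h2 := key _ _ _ _ (swapRow _ _ _ _ h0)
    rw [det_fin_two, h1, h2] at hB
    simp at hB
  classical
  obtain ⟨hn0, a, b, c, d, hX, hXn⟩ := Nat.find_spec hex
  have hmin : ∀ a' b' c' d', O a' b' c' d' → d'.natAbs < d.natAbs → d' = 0 := by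
    intro a' b' c' d' hY hlt
    by_contra h
    rw [hXn] at hlt
    exact Nat.find_min hex hlt ⟨Int.natAbs_ne_zero.mpr h, a', b', c', d', hY, rfl⟩
  have hd0 : d ≠ 0 := by
    rw [← hXn] at hn0
    exact Int.natAbs_ne_zero.mp hn0
  have hlt : ∀ z : ℤ, (z % d).natAbs < d.natAbs := fun z => by
    zify
    rw [abs_of_nonneg (Int.emod_nonneg z hd0)]
    exact Int.emod_lt_abs z hd0
  have hmod : ∀ z : ℤ, z + -(z / d) * d = z % d := fun z => by
    have := Int.emod_add_mul_ediv z d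
    linarith
  have hrow : ∀ a' b' c', O a' b' c' d → d ∣ c' := by
    intro a' b' c' hY
    have h2 := swapCol _ _ _ _ (addCol _ _ _ _ (-(c' / d)) hY)
    rw [hmod] at h2
    exact Int.dvd_of_emod_eq_zero (hmin _ _ _ _ h2 (hlt _))
  have hcol : ∀ a' b' c', O a' b' c' d → d ∣ b' := by
    intro a' b' c' hY
    have h2 := swapRow _ _ _ _ (addRow _ _ _ _ (-(b' / d)) hY)
    rw [hmod] at h2
    exact Int.dvd_of_emod_eq_zero (hmin _ _ _ _ h2 (hlt _))
  obtain ⟨s, rfl⟩ := hrow _ _ _ hX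
  obtain ⟨t, rfl⟩ := hcol _ _ _ hX
  have hZ := addCol _ _ _ _ (-s) (addRow _ _ _ _ (-t) hX)
  rw [show d * t + -t * d = 0 by ring, show d * s + -s * d = 0 by ring, mul_zero, add_zero] at hZ
  set z := a + -t * (d * s)
  obtain ⟨m, hm⟩ : d ∣ z := by
    have := addRow' _ _ _ _ hZ
    rw [zero_add, add_zero] at this
    exact hrow _ _ _ this
  obtain ⟨γ₁, γ₂, hγ⟩ := hZ
  have hBZ : B = (γ₁⁻¹).1 * !![d * m, 0; 0, d] * (γ₂⁻¹).1 := by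
    have h1 : (γ₁⁻¹).1 * γ₁.1 = 1 :=
      (SpecialLinearGroup.coe_mul _ _).symm.trans (by rw [inv_mul_cancel]; rfl)
    have h2 : γ₂.1 * (γ₂⁻¹).1 = 1 :=
      (SpecialLinearGroup.coe_mul _ _).symm.trans (by rw [mul_inv_cancel]; rfl)
    rw [← hm, hγ]
    calc B = 1 * B * 1 := by rw [Matrix.one_mul, Matrix.mul_one]
      _ = ((γ₁⁻¹).1 * γ₁.1) * B * (γ₂.1 * (γ₂⁻¹).1) := by rw [h1, h2]
      _ = _ := by simp only [Matrix.mul_assoc]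
  refine ⟨γ₁⁻¹, γ₂⁻¹, d, m, ?_, hd0, hBZ⟩
  have hdet : B.det = d * d * m := by
    rw [hBZ, det_mul, det_mul, (γ₁⁻¹).2, (γ₂⁻¹).2, det_fin_two_of]
    ring
  rw [hdet] at hB
  exact pos_of_mul_pos_right hB (mul_self_nonneg _)

end Matrix

/-! ### Auxiliary primes -/

section Arithmetic

open scoped NumberTheorySymbols

/-- If `4 ∤ N`, a prime `p ≡ -1 mod N` can be chosen with `p ≡ 1 mod 4`, and is then a sum of two
squares. -/
theorem exists_sq_add_sq_add_one_dvd {N : ℕ} (hN : ¬ 4 ∣ N) :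
    ∃ a b : ℤ, (N : ℤ) ∣ a * a + b * b + 1 := by
  obtain ⟨n, hn, hNn⟩ : ∃ n : ℕ, Nat.Coprime 4 n ∧ N ∣ 2 * n := by
    rcases Nat.even_or_odd' N with ⟨n, rfl | rfl⟩
    · have : Odd n := by
        by_contra h
        rw [Nat.not_odd_iff_even] at h
        obtain ⟨k, rfl⟩ := h
        exact hN ⟨k, by ring⟩
      exact ⟨n, Nat.Coprime.pow_left 2 (Nat.coprime_two_left.mpr this), dvd_rfl⟩
    · exact ⟨2 * n + 1, Nat.Coprime.pow_left 2 (Nat.coprime_two_left.mpr ⟨n, rfl⟩),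
        Dvd.intro_left 2 rfl⟩
  have hn0 : n ≠ 0 := by rintro rfl; norm_num at hn
  obtain ⟨z, hz1, hz2⟩ := Nat.chineseRemainder hn 1 (n - 1)
  have hu : IsUnit (z : ZMod (4 * n)) := by
    rw [ZMod.isUnit_iff_coprime]
    refine Nat.Coprime.mul_right ?_ ?_
    · exact (hz1.gcd_eq).trans (by norm_num)
    · exact (hz2.gcd_eq).trans ((Nat.coprime_self_sub_left (Nat.one_le_iff_ne_zero.mpr hn0)).mpr
        (Nat.coprime_one_left n))
  have : NeZero (4 * n) := ⟨by positivity⟩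
  obtain ⟨p, -, hp, hpz⟩ := Nat.forall_exists_prime_gt_and_eq_mod hu 0
  rw [ZMod.natCast_eq_natCast_iff] at hpz
  have h4 : p ≡ 1 [MOD 4] := (hpz.of_mul_right n).trans hz1
  have hpn : p ≡ n - 1 [MOD n] := (hpz.of_mul_left 4).trans hz2
  have := Fact.mk hp
  have h4' : p % 4 = 1 := h4
  obtain ⟨a, b, hab⟩ := Nat.Prime.sq_add_sq (p := p) (by omega)
  refine ⟨a, b, ?_⟩
  have h1 : (n : ℤ) ∣ p + 1 := by
    have : p + 1 ≡ 0 [MOD n] := by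
      have := hpn.add_right 1
      rw [Nat.sub_add_cancel (Nat.one_le_iff_ne_zero.mpr hn0)] at this
      exact this.trans (by simp [Nat.ModEq])
    exact_mod_cast (Nat.modEq_zero_iff_dvd.mp this)
  have h2 : (2 : ℤ) ∣ p + 1 := by omega
  have h3 : IsCoprime (2 : ℤ) n := by
    have : Nat.Coprime 2 n := Nat.Coprime.coprime_dvd_left ⟨2, rfl⟩ hn
    exact_mod_cast Nat.isCoprime_iff_coprime.mpr this
  have h5 : (a * a + b * b + 1 : ℤ) = p + 1 := by rw [← hab]; push_cast; ring
  rw [h5]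
  exact (Int.natCast_dvd_natCast.mpr hNn).trans (by push_cast; exact h3.mul_dvd h2 h1)

theorem exists_jacobiSym_eq_neg_one {m : ℕ} (hm : Odd m) (hsq : ¬ IsSquare m) :
    ∃ a : ℕ, J(a | m) = -1 := by
  have hm0 : m ≠ 0 := by rintro rfl; exact hsq ⟨0, rfl⟩
  -- some prime occurs in `m` with odd exponent
  obtain ⟨p, hp, hodd⟩ : ∃ p : ℕ, p.Prime ∧ Odd (m.factorization p) := by
    by_contra! h
    apply hsq
    refine ⟨m.factorization.prod fun p k => p ^ (k / 2), ?_⟩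
    rw [← Finsupp.prod_mul]
    conv_lhs => rw [← Nat.prod_factorization_pow_eq_self hm0]
    refine Finsupp.prod_congr fun p hp => ?_
    have := h p (Nat.prime_of_mem_primeFactors (Nat.support_factorization m ▸ hp))
    rw [Nat.not_odd_iff_even] at this
    rw [← pow_add]
    congr 1
    obtain ⟨k, hk⟩ := this
    omega
  have := Fact.mk hp
  have hp2 : p ≠ 2 := by
    rintro rfl
    have : m.factorization 2 = 0 := Nat.factorization_eq_zero_of_not_dvd
      (by rw [← even_iff_two_dvd, Nat.not_even_iff_odd]; exact hm)
    rw [this] at hodd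
    simp at hodd
  have hmp : p ^ m.factorization p * (m / p ^ m.factorization p) = m :=
    Nat.ordProj_mul_ordCompl_eq_self m p
  set k := m.factorization p
  set m' := m / p ^ k with hm'
  have hm'0 : m' ≠ 0 := by
    intro h
    rw [h, mul_zero] at hmp
    exact hm0 hmp.symm
  have hcop : Nat.Coprime p m' := Nat.coprime_ordCompl hp hm0
  obtain ⟨y, hy⟩ := FiniteField.exists_nonsquare (F := ZMod p) (by rwa [ZMod.ringChar_zmod_n])
  obtain ⟨a, ha1, ha2⟩ := Nat.chineseRemainder hcop y.val 1
  refine ⟨a, ?_⟩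
  have : NeZero m' := ⟨hm'0⟩
  rw [← hmp, jacobiSym.mul_right, jacobiSym.pow_right]
  have e1 : J(a | p) = -1 := by
    rw [jacobiSym.mod_left' (b := p) (a₂ := y.val) (by exact_mod_cast ha1)]
    exact ZMod.nonsquare_iff_jacobiSym_eq_neg_one.mpr (by simpa using hy)
  have e2 : J(a | m') = 1 := by
    rw [jacobiSym.mod_left' (b := m') (a₂ := 1) (by exact_mod_cast ha2), jacobiSym.one_left]
  rw [e1, e2, hodd.neg_one_pow, mul_one]

/-- For `m ≡ 1 mod 4` prime to `N` and not a square there is a prime `x ≡ -1 mod N` modulo which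
`m` is not a quadratic residue; by Euler's criterion, `x` divides `m ^ (x / 2) + 1`. -/
theorem exists_dvd_pow_add_one {N m : ℕ} (hN : N ≠ 0) (h4 : 4 ∣ N) (hm : m % 4 = 1)
    (hcop : Nat.Coprime N m) (hsq : ¬ IsSquare m) :
    ∃ x k : ℕ, N ∣ x + 1 ∧ x ∣ m ^ k + 1 := by
  have hmo : Odd m := Nat.odd_iff.mpr (by omega)
  obtain ⟨a, ha⟩ := exists_jacobiSym_eq_neg_one hmo hsq
  have hm0 : m ≠ 0 := by omega
  have hac : Nat.Coprime a m := by
    have h0 : J(a | m) ≠ 0 := by rw [ha]; norm_num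
    have : NeZero m := ⟨hm0⟩
    by_contra h
    exact h0 (jacobiSym.eq_zero_iff_not_coprime.mpr (by simpa using h))
  obtain ⟨z, hz1, hz2⟩ := Nat.chineseRemainder hcop (N - 1) a
  have hu : IsUnit (z : ZMod (N * m)) := by
    rw [ZMod.isUnit_iff_coprime]
    refine Nat.Coprime.mul_right ?_ ?_
    · exact (hz1.gcd_eq).trans ((Nat.coprime_self_sub_left (Nat.one_le_iff_ne_zero.mpr hN)).mpr
        (Nat.coprime_one_left N))
    · exact (hz2.gcd_eq).trans hac
  have : NeZero (N * m) := ⟨by positivity⟩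
  obtain ⟨x, -, hx, hxz⟩ := Nat.forall_exists_prime_gt_and_eq_mod hu 0
  rw [ZMod.natCast_eq_natCast_iff] at hxz
  have h1 : x ≡ N - 1 [MOD N] := (hxz.of_mul_right m).trans hz1
  have h2 : x ≡ a [MOD m] := (hxz.of_mul_left N).trans hz2
  have hNx : N ∣ x + 1 := by
    have := h1.add_right 1
    rw [Nat.sub_add_cancel (Nat.one_le_iff_ne_zero.mpr hN)] at this
    exact Nat.modEq_zero_iff_dvd.mp (this.trans (by simp [Nat.ModEq]))
  refine ⟨x, x / 2, hNx, ?_⟩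
  have := Fact.mk hx
  have hxo : Odd x := Nat.odd_iff.mpr (by have := h4.trans hNx; omega)
  have e1 : J(m | x) = -1 := by
    rw [jacobiSym.quadratic_reciprocity_one_mod_four hm hxo,
      jacobiSym.mod_left' (b := m) (a₂ := a) (by exact_mod_cast h2), ha]
  have e2 := legendreSym.eq_pow x (m : ℤ)
  rw [jacobiSym.legendreSym.to_jacobiSym, e1] at e2
  rw [← ZMod.natCast_eq_zero_iff]
  push_cast at e2 ⊢
  rw [← e2]
  ring

end Arithmetic

/-! ### The reduction map of the integral metaplectic group -/

namespace Metaplectic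

open scoped MatrixGroups UpperHalfPlane Manifold
open UpperHalfPlane

noncomputable section

/-- The covering map `Mp₂(ℤ) → SL₂(ℤ)`. -/
def toSL : integral →* SL(2, ℤ) :=
  (MonoidHom.ofInjective (Matrix.SpecialLinearGroup.mapGL_injective (R := ℤ) (S := ℝ)
    (n := Fin 2))).symm.toMonoidHom.comp
    ((toGL.comp integral.subtype).codRestrict _ fun g => g.2)

theorem mapGL_toSL (g : integral) : Matrix.SpecialLinearGroup.mapGL ℝ (toSL g) = g.1.mat :=
  MonoidHom.apply_ofInjective_symm Matrix.SpecialLinearGroup.mapGL_injective _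

theorem toSL_mul_val (g h : integral) : (toSL (g * h)).1 = (toSL g).1 * (toSL h).1 := by
  rw [map_mul]; rfl

theorem toSL_mul_toSL_inv (g : integral) : (toSL g).1 * (toSL g⁻¹).1 = 1 := by
  rw [← toSL_mul_val, mul_inv_cancel, map_one]; rfl

theorem toSL_eq {g : integral} {γ : SL(2, ℤ)}
    (h : g.1.mat = Matrix.SpecialLinearGroup.mapGL ℝ γ) : toSL g = γ :=
  Matrix.SpecialLinearGroup.mapGL_injective ((mapGL_toSL g).trans h)

theorem toSL_S : toSL ⟨S, S_mem⟩ = ModularGroup.S := toSL_eq rfl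

theorem toSL_T : toSL ⟨T, T_mem⟩ = ModularGroup.T := toSL_eq rfl

theorem toSL_surjective : Function.Surjective toSL := by
  intro γ
  have hγ : γ ∈ Subgroup.closure {ModularGroup.S, ModularGroup.T} := by
    simp [SpecialLinearGroup.SL2Z_generators]
  have hle : Subgroup.closure {ModularGroup.S, ModularGroup.T} ≤ toSL.range := by
    rw [Subgroup.closure_le]
    rintro x (rfl | rfl)
    · exact ⟨_, toSL_S⟩
    · exact ⟨_, toSL_T⟩
  exact hle hγ

theorem integral_induction {P : integral → Prop} (hS : P ⟨S, S_mem⟩) (hT : P ⟨T, T_mem⟩)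
    (one : P 1) (mul : ∀ g h, P g → P h → P (g * h)) (inv : ∀ g, P g → P g⁻¹) (g : integral) :
    P g := by
  have key : ∀ x (hx : x ∈ Subgroup.closure {S, T}) (hx' : x ∈ integral), P ⟨x, hx'⟩ := by
    intro x hx
    induction hx using Subgroup.closure_induction with
    | mem x hx =>
      intro _
      rcases hx with rfl | rfl
      · exact hS
      · exact hT
    | one => exact fun _ => one
    | mul x y hx hy ihx ihy =>
      intro _
      rw [closure_S_T] at hx hy
      exact mul _ _ (ihx hx) (ihy hy)
    | inv x hx ih =>
      intro _
      rw [closure_S_T] at hx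
      exact inv _ (ih hx)
  obtain ⟨x, hx⟩ := g
  exact key x (by rw [closure_S_T]; exact hx) hx

end

end Metaplectic

/-! ### The Heisenberg group and the scalars of the Weil representation -/

namespace DiscriminantForm

open scoped MatrixGroups UpperHalfPlane Manifold
open UpperHalfPlane

noncomputable section

section Level

variable {A : Type*} [AddCommGroup A] (D : DiscriminantForm A)

theorem b_self (x : A) : D.b x x = (2 : ℤ) • D.q x := by
  rw [b, QuadraticMap.polar_self]
  simp [two_smul]

theorem eq_zero_of_forall_b {x : A} (h : ∀ y, D.b x y = 0) : x = 0 := D.nondegenerate x h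

theorem intCast_eq_iff_dvd {m n : ℤ} :
    ((m : ZMod D.level) = n) ↔ (D.level : ℤ) ∣ m - n := by
  rw [← sub_eq_zero, ← Int.cast_sub, ZMod.intCast_zmod_eq_zero_iff_dvd]

variable [Fintype A]

theorem smul_q_of_dvd {n : ℤ} (h : (D.level : ℤ) ∣ n) (x : A) : n • D.q x = 0 := by
  obtain ⟨k, rfl⟩ := h
  rw [mul_comm, mul_smul, natCast_zsmul, D.level_spec.2, smul_zero]

theorem smul_b_of_dvd {n : ℤ} (h : (D.level : ℤ) ∣ n) (x y : A) : n • D.b x y = 0 := by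
  have h1 := congrArg (n • ·) (D.q_add x y)
  simpa [smul_q_of_dvd D h] using h1.symm

theorem smul_of_dvd {n : ℤ} (h : (D.level : ℤ) ∣ n) (x : A) : n • x = 0 :=
  D.eq_zero_of_forall_b fun y => by rw [b_smul_left, smul_b_of_dvd D h]

theorem smul_q_congr {m n : ℤ} (h : (m : ZMod D.level) = n) (x : A) : m • D.q x = n • D.q x := by
  rw [← sub_eq_zero, ← sub_smul, smul_q_of_dvd D (D.intCast_eq_iff_dvd.mp h)]

theorem smul_b_congr {m n : ℤ} (h : (m : ZMod D.level) = n) (x y : A) :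
    m • D.b x y = n • D.b x y := by
  rw [← sub_eq_zero, ← sub_smul, smul_b_of_dvd D (D.intCast_eq_iff_dvd.mp h)]

theorem smul_congr {m n : ℤ} (h : (m : ZMod D.level) = n) (x : A) : m • x = n • x := by
  rw [← sub_eq_zero, ← sub_smul, smul_of_dvd D (D.intCast_eq_iff_dvd.mp h)]

theorem exists_e_b_ne {x y : A} (h : x ≠ y) : ∃ z, e (D.b z x) ≠ e (D.b z y) := by
  by_contra! hz
  refine h (sub_eq_zero.mp (D.eq_zero_of_forall_b fun z => e_eq_one ?_))
  rw [b_comm, sub_eq_add_neg, b_add_right, b_comm D z (-y), b_neg_left, AddChar.map_add_eq_mul, hz,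
    b_comm D y z, e_mul_e_neg]

end Level

variable {A : Type*} [AddCommGroup A] [Fintype A] [DecidableEq A] (D : DiscriminantForm A)

/-- The Heisenberg operator `e_z ↦ e(v₀v₁ x²/2 + v₀ (x, z)) e_{z + v₁x}`. The quadratic phase is
chosen such that the Weil representation permutes these operators without further scalars. -/
def heisenberg (v : Fin 2 → ℤ) (x : A) : Matrix A A ℂ :=
  Matrix.of fun y z => if y = z + v 1 • x then e ((v 0 * v 1) • D.q x + v 0 • D.b x z) else 0

theorem mul_heisenberg_apply (M : Matrix A A ℂ) (v : Fin 2 → ℤ) (x y z : A) :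
    (M * D.heisenberg v x) y z =
      M y (z + v 1 • x) * e ((v 0 * v 1) • D.q x + v 0 • D.b x z) := by
  rw [Matrix.mul_apply, Finset.sum_eq_single (z + v 1 • x)]
  · simp [heisenberg]
  · intro w _ hw
    simp [heisenberg, hw]
  · simp

theorem heisenberg_mul_apply (M : Matrix A A ℂ) (v : Fin 2 → ℤ) (x y z : A) :
    (D.heisenberg v x * M) y z =
      e ((v 0 * v 1) • D.q x + v 0 • D.b x (y - v 1 • x)) * M (y - v 1 • x) z := by
  rw [Matrix.mul_apply, Finset.sum_eq_single (y - v 1 • x)]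
  · simp [heisenberg]
  · intro w _ hw
    have : y ≠ w + v 1 • x := fun h => hw (eq_sub_of_add_eq h.symm)
    simp [heisenberg, this]
  · simp

theorem heisenberg_congr {v w : Fin 2 → ℤ} (h : ∀ i, (v i : ZMod D.level) = w i) (x : A) :
    D.heisenberg v x = D.heisenberg w x := by
  ext y z
  have h01 : ((v 0 * v 1 : ℤ) : ZMod D.level) = (w 0 * w 1 : ℤ) := by
    push_cast; rw [h, h]
  simp only [heisenberg, Matrix.of_apply]
  rw [D.smul_congr (h 1), D.smul_q_congr h01, D.smul_b_congr (h 0)]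

theorem weilRep_mul_val (g h : Metaplectic.integral) :
    (D.weilRep (g * h)).1 = (D.weilRep g).1 * (D.weilRep h).1 := by
  rw [map_mul]; rfl

theorem weilRep_mul_weilRep_inv (g : Metaplectic.integral) :
    (D.weilRep g).1 * (D.weilRep g⁻¹).1 = 1 := by
  rw [← weilRep_mul_val, mul_inv_cancel, map_one]; rfl

theorem weilRep_inv_mul_weilRep (g : Metaplectic.integral) :
    (D.weilRep g⁻¹).1 * (D.weilRep g).1 = 1 := by
  rw [← weilRep_mul_val, inv_mul_cancel, map_one]; rfl

theorem weilT_mul_heisenberg (v : Fin 2 → ℤ) (x : A) :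
    D.weilT * D.heisenberg v x =
      D.heisenberg (ModularGroup.T.1.mulVec v) x * D.weilT := by
  have hv0 : ModularGroup.T.1.mulVec v 0 = v 0 + v 1 := by
    simp [ModularGroup.T, Matrix.mulVec, dotProduct, Fin.sum_univ_two]
  have hv1 : ModularGroup.T.1.mulVec v 1 = v 1 := by
    simp [ModularGroup.T, Matrix.mulVec, dotProduct, Fin.sum_univ_two]
  ext y z
  rw [mul_heisenberg_apply, heisenberg_mul_apply, hv0, hv1]
  simp only [weilT, Matrix.diagonal_apply]
  by_cases hy : y = z + v 1 • x
  · subst hy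
    simp only [if_true, add_sub_cancel_right, ← AddChar.map_add_eq_mul]
    congr 1
    rw [q_add, q_smul, b_smul_right, D.b_comm z x]
    module
  · rw [if_neg hy, if_neg (fun h => hy (by rw [← h]; simp))]
    simp

theorem weilS_mul_heisenberg (v : Fin 2 → ℤ) (x : A) :
    D.weilS * D.heisenberg v x =
      D.heisenberg (ModularGroup.S.1.mulVec v) x * D.weilS := by
  have hv0 : ModularGroup.S.1.mulVec v 0 = -v 1 := by
    simp [ModularGroup.S, Matrix.mulVec, dotProduct, Fin.sum_univ_two]
  have hv1 : ModularGroup.S.1.mulVec v 1 = v 0 := by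
    simp [ModularGroup.S, Matrix.mulVec, dotProduct, Fin.sum_univ_two]
  ext y z
  rw [mul_heisenberg_apply, heisenberg_mul_apply, hv0, hv1]
  simp only [weilS, Matrix.of_apply]
  rw [mul_assoc, mul_left_comm (e _) D.weilConst, ← AddChar.map_add_eq_mul,
    ← AddChar.map_add_eq_mul]
  congr 2
  have h1 : D.b x (y - v 0 • x) = D.b x y + (-(2 * v 0)) • D.q x := by
    rw [sub_eq_add_neg, b_add_right, ← _root_.neg_smul, b_smul_right, b_self]; module
  have h2 : D.b z (y - v 0 • x) = D.b z y + (-v 0) • D.b x z := by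
    rw [sub_eq_add_neg, b_add_right, ← _root_.neg_smul, b_smul_right, D.b_comm z x]
  have h3 : D.b (z + v 1 • x) y = D.b z y + v 1 • D.b x y := by
    rw [b_add_left, b_smul_left]
  rw [h1, h2, h3]
  module

/-- The Weil representation normalises the Heisenberg group, on which it acts through
`SL₂(ℤ)`. -/
theorem weilRep_mul_heisenberg (g : Metaplectic.integral) : ∀ (v : Fin 2 → ℤ) (x : A),
    (D.weilRep g).1 * D.heisenberg v x =
      D.heisenberg ((Metaplectic.toSL g).1.mulVec v) x * (D.weilRep g).1 := by
  induction g using Metaplectic.integral_induction with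
  | hS =>
    intro v x
    rw [weilRep_S, Metaplectic.toSL_S]
    exact D.weilS_mul_heisenberg v x
  | hT =>
    intro v x
    rw [weilRep_T, Metaplectic.toSL_T]
    exact D.weilT_mul_heisenberg v x
  | one => intro v x; simp
  | mul g h hg hh =>
    intro v x
    rw [weilRep_mul_val, Metaplectic.toSL_mul_val, mul_assoc, hh, ← mul_assoc, hg,
      mul_assoc, Matrix.mulVec_mulVec]
  | inv g hg =>
    intro v x
    have := hg ((Metaplectic.toSL g⁻¹).1.mulVec v) x
    rw [Matrix.mulVec_mulVec, Metaplectic.toSL_mul_toSL_inv, Matrix.one_mulVec] at this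
    calc _ = (D.weilRep g⁻¹).1 * (D.heisenberg v x * (D.weilRep g).1) * (D.weilRep g⁻¹).1 := by
          rw [mul_assoc, mul_assoc, weilRep_mul_weilRep_inv, mul_one]
      _ = _ := by rw [← this, ← mul_assoc, weilRep_inv_mul_weilRep, one_mul]

/-- Irreducibility of the Heisenberg group: its commutant is scalar. -/
theorem eq_smul_one_of_commute_heisenberg {M : Matrix A A ℂ}
    (h : ∀ v x, M * D.heisenberg v x = D.heisenberg v x * M) : ∃ ζ : ℂ, M = ζ • 1 := by
  refine ⟨M 0 0, ?_⟩
  have hoff : ∀ y z, y ≠ z → M y z = 0 := by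
    intro y z hyz
    obtain ⟨x, hx⟩ := D.exists_e_b_ne hyz
    have h1 := congrFun (congrFun (h ![1, 0] x) y) z
    rw [mul_heisenberg_apply, heisenberg_mul_apply] at h1
    simp at h1
    by_contra h0
    rw [mul_comm] at h1
    exact hx (mul_right_cancel₀ h0 h1).symm
  ext y z
  by_cases hyz : y = z
  · subst hyz
    have h1 := congrFun (congrFun (h ![0, 1] y) y) 0
    rw [mul_heisenberg_apply, heisenberg_mul_apply] at h1
    simp at h1
    simpa using h1
  · simp [hoff y z hyz, hyz]

/-- The principal congruence subgroup of level `N` acts by scalars. -/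
theorem exists_weilRep_eq_smul_one {g : Metaplectic.integral}
    (hg : ∀ i j, ((Metaplectic.toSL g).1 i j : ZMod D.level) = (1 : Matrix _ _ ℤ) i j) :
    ∃ ζ : ℂ, (D.weilRep g).1 = ζ • 1 := by
  refine D.eq_smul_one_of_commute_heisenberg fun v x => ?_
  rw [weilRep_mul_heisenberg]
  congr 1
  refine D.heisenberg_congr (fun i => ?_) x
  have h1 : (Metaplectic.toSL g).1.mulVec v i =
      (Metaplectic.toSL g).1 i 0 * v 0 + (Metaplectic.toSL g).1 i 1 * v 1 := by
    simp [Matrix.mulVec, dotProduct, Fin.sum_univ_two]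
  rw [h1]
  push_cast
  rw [hg, hg]
  fin_cases i <;> simp [Matrix.one_apply]

theorem exists_weilRep_eq_smul {g h : Metaplectic.integral}
    (hgh : (Metaplectic.toSL g).1.map (fun a : ℤ => (a : ZMod D.level)) =
      (Metaplectic.toSL h).1.map (fun a : ℤ => (a : ZMod D.level))) :
    ∃ ζ : ℂ, (D.weilRep h).1 = ζ • (D.weilRep g).1 := by
  have key : ((Metaplectic.toSL (h * g⁻¹)).1).map (Int.castRingHom (ZMod D.level)) = 1 := by
    have e4 : (Metaplectic.toSL h).1.map (Int.castRingHom (ZMod D.level)) =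
      (Metaplectic.toSL g).1.map (Int.castRingHom (ZMod D.level)) := hgh.symm
    rw [Metaplectic.toSL_mul_val, Matrix.map_mul, e4, ← Matrix.map_mul,
      Metaplectic.toSL_mul_toSL_inv]
    exact Matrix.map_one _ (map_zero _) (map_one _)
  obtain ⟨ζ, hζ⟩ := D.exists_weilRep_eq_smul_one (g := h * g⁻¹) fun i j => by
    have := congrFun (congrFun key i) j
    rw [Matrix.map_apply] at this
    refine Eq.trans this ?_
    simp [Matrix.one_apply]
  refine ⟨ζ, ?_⟩
  rw [← one_mul (D.weilRep g).1, ← smul_mul_assoc, ← hζ, ← weilRep_mul_val, inv_mul_cancel_right]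

/-- An element whose reduction modulo `N` is diagonal preserves the line of `e₀` and its
orthogonal complement. -/
theorem weilRep_apply_zero {g : Metaplectic.integral}
    (h01 : ((Metaplectic.toSL g).1 0 1 : ZMod D.level) = 0)
    (h10 : ((Metaplectic.toSL g).1 1 0 : ZMod D.level) = 0) {z : A} (hz : z ≠ 0) :
    (D.weilRep g).1 0 z = 0 ∧ (D.weilRep g).1 z 0 = 0 := by
  set γ := (Metaplectic.toSL g).1 with hγ
  have hdet : ((γ 0 0 * γ 1 1 : ℤ) : ZMod D.level) = (1 : ℤ) := by
    have h1 := (Metaplectic.toSL g).2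
    rw [Matrix.det_fin_two] at h1
    have h2 := congrArg (fun a : ℤ => (a : ZMod D.level)) h1
    push_cast at h2 ⊢
    rw [h01, zero_mul, sub_zero] at h2
    exact h2
  have key : ∀ x, (D.weilRep g).1 * D.heisenberg ![1, 0] x =
      D.heisenberg ![γ 0 0, 0] x * (D.weilRep g).1 := by
    intro x
    rw [weilRep_mul_heisenberg]
    congr 1
    refine D.heisenberg_congr (fun i => ?_) x
    fin_cases i
    · simp [Matrix.mulVec, dotProduct, Fin.sum_univ_two, hγ]
    · simp [Matrix.mulVec, dotProduct, Fin.sum_univ_two, ← hγ, h10]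
  obtain ⟨x, hx⟩ := D.exists_e_b_ne hz
  rw [D.b_comm x 0, b_zero_left, AddChar.map_zero_eq_one] at hx
  constructor
  · have h1 := congrFun (congrFun (key x) 0) z
    rw [mul_heisenberg_apply, heisenberg_mul_apply] at h1
    simp [D.b_comm x 0, b_zero_left] at h1
    by_contra h0
    exact hx (mul_left_cancel₀ h0 (h1.trans (mul_one _).symm))
  · have h1 := congrFun (congrFun (key (γ 1 1 • x)) z) 0
    rw [mul_heisenberg_apply, heisenberg_mul_apply] at h1
    simp only [Matrix.cons_val_zero, Matrix.cons_val_one, mul_zero, zero_mul, zero_smul, zero_add,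
      sub_zero, b_smul_left, smul_smul] at h1
    rw [D.smul_b_congr hdet, one_smul, D.b_comm x 0, b_zero_left, smul_zero,
      AddChar.map_zero_eq_one, mul_one] at h1
    by_contra h0
    exact hx (mul_right_cancel₀ h0 (h1.symm.trans (one_mul _).symm))

theorem weilRep_det_pow (g : Metaplectic.integral) :
    (D.weilRep g).1.det ^ (8 * D.level) = 1 := by
  let f : Metaplectic.integral →* ℂˣ :=
    ((powMonoidHom (8 * D.level)).comp (Matrix.detMonoidHom.comp
      ((Submonoid.subtype _).comp D.weilRep))).toHomUnits
  have hf : ∀ g, ((f g : ℂˣ) : ℂ) = (D.weilRep g).1.det ^ (8 * D.level) := fun g => rfl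
  have : f = 1 := by
    refine Metaplectic.hom_ext (Units.ext ?_) (Units.ext ?_)
    · have h8 := congrArg Subtype.val D.weilSU_pow_eight
      change D.weilSU.1 ^ 8 = 1 at h8
      rw [hf, weilRep_S, pow_mul, ← Matrix.det_pow, h8]
      simp
    · rw [hf, weilRep_T, mul_comm, pow_mul]
      change (Matrix.det (Matrix.diagonal _) ^ D.level) ^ 8 = _
      rw [Matrix.det_diagonal, ← Finset.prod_pow, Finset.prod_eq_one]
      · simp
      · intro x _
        rw [← AddChar.map_nsmul_eq_pow, D.level_spec.2, AddChar.map_zero_eq_one]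
  rw [← hf, this]
  rfl

end

end DiscriminantForm

/-! ### Gauss sums in odd signature -/

namespace DiscriminantForm

open scoped MatrixGroups UpperHalfPlane Manifold
open UpperHalfPlane

noncomputable section

section Gauss

variable {A : Type*} [AddCommGroup A] [Fintype A] (D : DiscriminantForm A)

theorem conj_gaussSum_one : (starRingEnd ℂ) (D.gaussSum 1) = ∑ x, e (-D.q x) := by
  rw [gaussSum_one, map_sum]
  simp only [conj_e]

theorem sum_e_neg_q_smul {t : ℤ} (ht : IsUnit (t : ZMod D.level)) :
    ∑ x, e (-D.q (t • x)) = (starRingEnd ℂ) (D.gaussSum 1) := by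
  rw [conj_gaussSum_one]
  obtain ⟨s, hs⟩ := ht.exists_left_inv
  obtain ⟨s, rfl⟩ := ZMod.intCast_surjective s
  have hst : ((s * t : ℤ) : ZMod D.level) = (1 : ℤ) := by push_cast; exact hs
  have hinj : Function.Injective fun x : A => t • x := by
    intro x y hxy
    have h1 := congrArg (s • ·) hxy
    simp only [smul_smul] at h1
    rwa [D.smul_congr hst, D.smul_congr hst, one_smul, one_smul] at h1
  exact Fintype.sum_bijective _ hinj.bijective_of_finite _ _ fun x => rfl

theorem conj_gaussSum_sq_ne (hodd : Odd D.signature) :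
    (starRingEnd ℂ) (D.gaussSum 1) ^ 2 ≠ D.gaussSum 1 ^ 2 := by
  intro h
  have hs : Odd D.signature.val := by
    obtain ⟨k, hk⟩ := hodd
    rw [hk]
    clear hk
    revert k
    decide
  rw [gaussSum_one, milgram, map_mul, Complex.conj_ofReal, conj_e, mul_pow, mul_pow] at h
  have h1 := mul_left_cancel₀ (pow_ne_zero 2 (sqrt_card_ne (A := A))) h
  set θ : AddCircle (1 : ℚ) := (((D.signature.val : ℚ) / 8 : ℚ) : AddCircle (1 : ℚ)) with hθ
  have h2 : e ((4 : ℕ) • θ) = 1 := by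
    rw [AddChar.map_nsmul_eq_pow]
    calc e θ ^ 4 = e θ ^ 2 * e θ ^ 2 := by ring
      _ = (e θ * e (-θ)) ^ 2 := by nth_rewrite 1 [← h1]; ring
      _ = 1 := by rw [e_mul_e_neg, one_pow]
  have h3 := e_eq_one h2
  rw [hθ, ← AddCircle.coe_nsmul, AddCircle.coe_eq_zero_iff] at h3
  obtain ⟨n, hn⟩ := h3
  have h4 : (D.signature.val : ℤ) = 2 * n := by
    have : (D.signature.val : ℚ) = 2 * n := by
      simp only [zsmul_eq_mul, mul_one, nsmul_eq_mul] at hn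
      push_cast at hn
      linarith
    exact_mod_cast this
  obtain ⟨k, hk⟩ := hs
  omega

/-- If `-1` is a sum of two squares modulo `N`, multiplication by a Gaussian integer identifies
`A ⊕ A` with its negative. -/
theorem conj_gaussSum_sq_of_dvd {a b : ℤ} (h : (D.level : ℤ) ∣ a * a + b * b + 1) :
    (starRingEnd ℂ) (D.gaussSum 1) ^ 2 = D.gaussSum 1 ^ 2 := by
  have h' : (D.level : ℤ) ∣ (a * a + b * b) - (-1) := by simpa using h
  have hsq : ∀ f : A → ℂ, (∑ x, f x) ^ 2 = ∑ v : A × A, f v.1 * f v.2 := by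
    intro f
    simp only [Fintype.sum_prod_type, ← Finset.mul_sum, ← Finset.sum_mul]
    ring
  have hcast := D.intCast_eq_iff_dvd.mpr h'
  have hA : ∀ x : A, (a * a + b * b) • x = -x := fun x => by
    rw [D.smul_congr hcast]; simp
  have hq : ∀ x : A, (a * a + b * b) • D.q x = -D.q x := fun x => by
    rw [D.smul_q_congr hcast]; simp
  let F : A × A → A × A := fun v => (a • v.1 + (-b) • v.2, b • v.1 + a • v.2)
  have hinj : Function.Injective F := by
    rintro ⟨x, y⟩ ⟨x', y'⟩ hxy
    simp only [F, Prod.mk.injEq] at hxy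
    have e1 : ∀ x y : A, a • (a • x + (-b) • y) + b • (b • x + a • y) = -x := fun x y => by
      rw [← hA]; module
    have e2 : ∀ x y : A, (-b) • (a • x + (-b) • y) + a • (b • x + a • y) = -y := fun x y => by
      rw [← hA]; module
    have h1 := e1 x y
    have h2 := e2 x y
    rw [hxy.1, hxy.2, e1, neg_inj] at h1
    rw [hxy.1, hxy.2, e2, neg_inj] at h2
    rw [h1, h2]
  rw [conj_gaussSum_one, gaussSum_one, hsq, hsq]
  refine (Fintype.sum_bijective F hinj.bijective_of_finite _ _ fun v => ?_)
  obtain ⟨x, y⟩ := v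
  rw [← AddChar.map_add_eq_mul, ← AddChar.map_add_eq_mul]
  congr 1
  rw [← hq, ← hq]
  simp only [F, q_add, q_smul, b_smul_left, b_smul_right]
  module

theorem four_dvd_level (hodd : Odd D.signature) : 4 ∣ D.level := by
  by_contra h
  obtain ⟨a, b, hab⟩ := exists_sq_add_sq_add_one_dvd h
  exact D.conj_gaussSum_sq_ne hodd (D.conj_gaussSum_sq_of_dvd hab)

end Gauss

variable {A : Type*} [AddCommGroup A] [Fintype A] [DecidableEq A] (D : DiscriminantForm A)

theorem weilRep_T_pow (n : ℕ) :
    (D.weilRep (⟨Metaplectic.T, Metaplectic.T_mem⟩ ^ n)).1 =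
      Matrix.diagonal fun x => e ((n : ℤ) • D.q x) := by
  rw [map_pow, weilRep_T]
  change D.weilT ^ n = _
  rw [weilT, Matrix.diagonal_pow]
  congr 1
  funext x
  rw [Pi.pow_apply, natCast_zsmul, AddChar.map_nsmul_eq_pow]

theorem weilRep_T_pow_mul_mul_apply_zero (g : Metaplectic.integral) (m n : ℕ) :
    (D.weilRep (⟨Metaplectic.T, Metaplectic.T_mem⟩ ^ m * g *
      ⟨Metaplectic.T, Metaplectic.T_mem⟩ ^ n)).1 0 0 = (D.weilRep g).1 0 0 := by
  rw [weilRep_mul_val, weilRep_mul_val, weilRep_T_pow, weilRep_T_pow, Matrix.mul_diagonal,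
    Matrix.diagonal_mul]
  simp

theorem weilRep_S_apply_zero :
    (D.weilRep ⟨Metaplectic.S, Metaplectic.S_mem⟩).1 0 0 = D.weilConst := by
  rw [weilRep_S]
  simp [weilSU, weilS, b_zero_left]

/-- For `x ≡ -1` and `xy ≡ 1 + t²` modulo `N`, completing the square evaluates this matrix entry
as a product of two Gauss sums. -/
theorem weilRep_STSTS_apply_zero {x y : ℕ} {t : ℤ} (hx : (x : ZMod D.level) = -1)
    (hy : (y : ZMod D.level) = -(1 + (t : ZMod D.level) ^ 2)) (ht : IsUnit (t : ZMod D.level)) :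
    (D.weilRep (⟨Metaplectic.S, Metaplectic.S_mem⟩ * ⟨Metaplectic.T, Metaplectic.T_mem⟩ ^ x *
      ⟨Metaplectic.S, Metaplectic.S_mem⟩ * ⟨Metaplectic.T, Metaplectic.T_mem⟩ ^ y *
      ⟨Metaplectic.S, Metaplectic.S_mem⟩)).1 0 0 =
      D.weilConst ^ 3 * (starRingEnd ℂ) (D.gaussSum 1) ^ 2 := by
  have hx' : ((x : ℤ) : ZMod D.level) = (-1 : ℤ) := by push_cast; exact hx
  have hy' : ((y : ℤ) : ZMod D.level) = (-(1 + t * t) : ℤ) := by push_cast; rw [hy]; ring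
  simp only [weilRep_mul_val, weilRep_T_pow, weilRep_S]
  change ((D.weilS * Matrix.diagonal (fun x' => e ((x : ℤ) • D.q x')) * D.weilS *
    Matrix.diagonal (fun x' => e ((y : ℤ) • D.q x')) * D.weilS : Matrix A A ℂ)) 0 0 = _
  rw [Matrix.mul_apply]
  simp only [Matrix.mul_diagonal, Matrix.mul_apply (M := D.weilS * _) (N := D.weilS)]
  simp only [weilS, Matrix.of_apply, b_zero_left, D.b_comm _ 0, neg_zero, AddChar.map_zero_eq_one,
    mul_one, D.smul_q_congr hx', D.smul_q_congr hy']
  have key : ∀ v : A, (∑ u, D.weilConst * e ((-1 : ℤ) • D.q u) *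
      (D.weilConst * e (-D.b v u))) * e ((-(1 + t * t)) • D.q v) * D.weilConst =
      D.weilConst ^ 3 * ((starRingEnd ℂ) (D.gaussSum 1) * e (-D.q (t • v))) := by
    intro v
    rw [conj_gaussSum_one, ← Equiv.sum_comp (Equiv.addRight v) (fun u => e (-D.q u)),
      Finset.sum_mul, Finset.sum_mul, Finset.sum_mul, Finset.mul_sum]
    refine Finset.sum_congr rfl fun u _ => ?_
    have : e ((-1 : ℤ) • D.q u) * e (-D.b v u) * e ((-(1 + t * t)) • D.q v) =
        e (-D.q (u + v)) * e (-D.q (t • v)) := by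
      simp only [← AddChar.map_add_eq_mul]
      congr 1
      rw [q_add, q_smul, D.b_comm v u]
      module
    rw [Equiv.coe_addRight, ← this]
    ring
  simp only [key, ← Finset.mul_sum]
  rw [D.sum_e_neg_q_smul ht]
  ring

end

end DiscriminantForm

/-! ### An identity in the metaplectic group -/

theorem Complex.mul_cpow_of_im_pos {a b : ℂ} (ha : 0 < a.im) (hb : 0 < b.im) (hab : 0 < (a * b).im)
    (s : ℂ) : a ^ s * b ^ s = (a * b) ^ s := by
  have ha0 : a ≠ 0 := by rintro rfl; simp at ha
  have hb0 : b ≠ 0 := by rintro rfl; simp at hb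
  have h1 : 0 < a.arg := lt_of_le_of_ne (arg_nonneg_iff.mpr ha.le)
    fun h => ha.ne' (arg_eq_zero_iff.mp h.symm).2
  have h2 : 0 < b.arg := lt_of_le_of_ne (arg_nonneg_iff.mpr hb.le)
    fun h => hb.ne' (arg_eq_zero_iff.mp h.symm).2
  have hsin : 0 < Real.sin (a.arg + b.arg) := by
    rw [Real.sin_add, sin_arg, sin_arg, cos_arg ha0, cos_arg hb0]
    have e1 : a.im / ‖a‖ * (b.re / ‖b‖) + a.re / ‖a‖ * (b.im / ‖b‖) =
        (a * b).im / (‖a‖ * ‖b‖) := by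
      rw [mul_im]; field_simp; ring
    rw [e1]
    exact div_pos hab (mul_pos (norm_pos_iff.mpr ha0) (norm_pos_iff.mpr hb0))
  have h3 : a.arg + b.arg < Real.pi := by
    by_contra! h
    have h4 := arg_le_pi a
    have h5 := arg_le_pi b
    have h6 : Real.sin (a.arg + b.arg) ≤ 0 := by
      have := Real.sin_nonneg_of_nonneg_of_le_pi (x := a.arg + b.arg - Real.pi) (by linarith)
        (by linarith)
      rw [Real.sin_sub_pi] at this
      linarith
    linarith
  rw [cpow_def_of_ne_zero ha0, cpow_def_of_ne_zero hb0, cpow_def_of_ne_zero (mul_ne_zero ha0 hb0),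
    ← exp_add, log_mul ha0 hb0 ⟨by linarith [Real.pi_pos], h3.le⟩]
  congr 1
  ring

namespace Metaplectic

open scoped MatrixGroups UpperHalfPlane Manifold
open UpperHalfPlane

theorem phi_eq_phi {g : Metaplectic} (h : (g.mat : Matrix (Fin 2) (Fin 2) ℝ) 1 0 = 0) (τ τ' : ℍ) :
    g.phi τ = g.phi τ' := by
  have hsq : ∀ σ, g.phi σ ^ 2 = g.phi τ' ^ 2 := fun σ => by
    rw [g.sq_phi, g.sq_phi, denom, denom, h]
    simp
  rcases (isPreconnected_univ (α := ℍ)).eq_or_eq_neg_of_sq_eq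
    (f := g.phi) (g := fun _ => g.phi τ') g.holo.continuous.continuousOn continuousOn_const
    (fun σ _ => hsq σ) (fun _ => g.phi_ne_zero _) with h1 | h1
  · exact h1 (Set.mem_univ τ)
  · exact absurd (self_eq_neg.mp (h1 (Set.mem_univ τ'))) (g.phi_ne_zero τ')

theorem T_pow_mat (n : ℕ) :
    ((T ^ n).mat : Matrix (Fin 2) (Fin 2) ℝ) = !![1, (n : ℝ); 0, 1] := by
  induction n with
  | zero => simp [Matrix.one_fin_two]
  | succ n ih =>
    rw [pow_succ, mul_mat, Units.val_mul, ih, T_mat]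
    ext i j
    fin_cases i <;> fin_cases j <;> simp [add_comm]

theorem T_pow_phi (n : ℕ) (τ : ℍ) : (T ^ n).phi τ = 1 := by
  induction n generalizing τ with
  | zero => simp
  | succ n ih =>
    rw [pow_succ, mul_phi, ih]
    exact one_mul _

theorem T_pow_smul (n : ℕ) (τ : ℍ) : (((T ^ n).mat • τ : ℍ) : ℂ) = τ + n := by
  rw [UpperHalfPlane.coe_smul_of_det_pos (T ^ n).det_pos]
  simp [num, denom, T_pow_mat]

/-- Conjugation by `diag(M, 1)` turns the lift `S Tˣ S Tʸ S` of `(-y, 1; M, -x)`, where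
`xy = M + 1`, into `T⁻ʸ S T⁻ˣ`. The content is the absence of a sign: the arguments of all square
roots involved, and of their products, lie in the upper half plane, where the principal branch is
multiplicative. -/
theorem T_pow_mul_conj_mul_T_pow {δ : Metaplectic} {c M : ℝ} (hM : 0 < M)
    (hδ : (δ.mat : Matrix (Fin 2) (Fin 2) ℝ) = !![c * M, 0; 0, c]) {x y : ℕ}
    (hxy : (x * y : ℝ) = M + 1) :
    T ^ y * (δ * (S * T ^ x * S * T ^ y * S) * δ⁻¹) * T ^ x = S := by
  have hy : (0 : ℝ) < y := by
    rcases Nat.eq_zero_or_pos y with rfl | h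
    · norm_num at hxy; linarith
    · exact_mod_cast h
  have hS : ∀ τ, S.phi τ = (τ : ℂ) ^ (1 / 2 : ℂ) := fun _ => rfl
  have hc : c ≠ 0 := by
    rintro rfl
    have h := δ.det_pos
    rw [Matrix.GeneralLinearGroup.val_det_apply, hδ, Matrix.det_fin_two_of] at h
    simp at h
  have hinv : ((δ⁻¹).mat : Matrix (Fin 2) (Fin 2) ℝ) = !![(c * M)⁻¹, 0; 0, c⁻¹] := by
    refine Units.inv_eq_of_mul_eq_one_right ?_
    rw [hδ]
    ext i j
    fin_cases i <;> fin_cases j <;> simp [hc]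
    field_simp
  have hδsmul : ∀ τ : ℍ, (((δ⁻¹).mat • τ : ℍ) : ℂ) = (M : ℂ)⁻¹ * τ := by
    intro τ
    have hc' : (c : ℂ) ≠ 0 := by exact_mod_cast hc
    rw [UpperHalfPlane.coe_smul_of_det_pos (δ⁻¹).det_pos]
    simp only [num, denom, hinv]
    simp
    field_simp
  refine eq_of_mat_eq (Units.ext ?_) UpperHalfPlane.I ?_
  · have hM' : M = x * y - 1 := by linarith
    simp only [mul_mat, Units.val_mul, S_mat, T_pow_mat, hδ, hinv]
    ext i j
    fin_cases i <;> fin_cases j <;> simp <;> field_simp <;> rw [hM'] <;> ring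
  · set w := UpperHalfPlane.I
    set τ : ℍ := (δ⁻¹).mat • (T ^ x).mat • w with hτ
    have hτ' : (M : ℂ) * τ = w + x := by
      rw [hτ, hδsmul, T_pow_smul, mul_inv_cancel_left₀]
      exact_mod_cast hM.ne'
    have hb : (((T ^ y).mat • S.mat • τ : ℍ) : ℂ) = -(τ : ℂ)⁻¹ + y := by
      rw [T_pow_smul, S_smul]
    have ha : (((T ^ x).mat • S.mat • (T ^ y).mat • S.mat • τ : ℍ) : ℂ) =
        -(-(τ : ℂ)⁻¹ + y)⁻¹ + x := by
      rw [T_pow_smul, S_smul, hb]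
    have hconst : δ.phi ((S * T ^ x * S * T ^ y * S).mat • τ) = δ.phi τ :=
      phi_eq_phi (by rw [hδ]; simp) _ _
    have hτ0 : (τ : ℂ) ≠ 0 := τ.ne_zero
    have hb0 : -(τ : ℂ)⁻¹ + y ≠ 0 := by rw [← hb]; exact UpperHalfPlane.ne_zero _
    have hbτ : (-(τ : ℂ)⁻¹ + y) * τ = y * τ - 1 := by
      field_simp
      ring
    have hfin : (-(-(τ : ℂ)⁻¹ + y)⁻¹ + x) * ((-(τ : ℂ)⁻¹ + y) * τ) = w := by
      have hxy' : (x * y : ℂ) = M + 1 := by exact_mod_cast hxy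
      rw [← mul_assoc, add_mul, neg_mul, inv_mul_cancel₀ hb0, add_mul, mul_assoc, hbτ]
      linear_combination τ.1 * hxy' + hτ'
    have him : 0 < ((-(τ : ℂ)⁻¹ + y) * τ).im := by
      rw [hbτ]
      simpa using mul_pos hy τ.im_pos
    have e1 : (-(τ : ℂ)⁻¹ + y) ^ (1 / 2 : ℂ) * (τ : ℂ) ^ (1 / 2 : ℂ) =
        ((-(τ : ℂ)⁻¹ + y) * τ) ^ (1 / 2 : ℂ) :=
      Complex.mul_cpow_of_im_pos (by rw [← hb]; exact UpperHalfPlane.im_pos _) τ.im_pos him _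
    have e2 := Complex.mul_cpow_of_im_pos (a := -(-(τ : ℂ)⁻¹ + y)⁻¹ + x)
      (by rw [← ha]; exact UpperHalfPlane.im_pos _) him (by rw [hfin]; exact w.im_pos) (1 / 2)
    rw [hfin, ← e1] at e2
    rw [hS w, ← e2]
    have hinvphi : (δ⁻¹).phi ((T ^ x).mat • w) = (δ.phi τ)⁻¹ := rfl
    have hcancel := mul_inv_cancel₀ (δ.phi_ne_zero τ)
    rw [mul_phi, T_pow_phi, mul_one, mul_phi, T_pow_phi, one_mul, mul_phi, hinvphi, ← hτ, mul_phi,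
      hconst]
    simp only [mul_phi, T_pow_phi, mul_one, hS]
    rw [ha, hb]
    linear_combination ((-(-(τ : ℂ)⁻¹ + y)⁻¹ + x) ^ (1 / 2 : ℂ) *
      ((-(τ : ℂ)⁻¹ + y) ^ (1 / 2 : ℂ) * (τ : ℂ) ^ (1 / 2 : ℂ))) * hcancel

end Metaplectic

/-! ### Hecke operators and central twists -/

namespace DiscriminantForm

open scoped MatrixGroups UpperHalfPlane Manifold
open UpperHalfPlane

noncomputable section

variable {A : Type*} [AddCommGroup A] [Fintype A] [DecidableEq A] (D : DiscriminantForm A)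

theorem integral_det (g : Metaplectic.integral) : g.1.mat.det.val = 1 := by
  rw [← Metaplectic.mapGL_toSL]
  simp

theorem slash_sectionL_mul {κ : ℤ} {f : ℍ → A → ℂ} (hf : f ∈ D.modularForms κ)
    (g : Metaplectic.integral) (η : D.Ambient) :
    D.slash κ (D.sectionL g * η) f = D.slash κ η f := by
  obtain ⟨-, hf, -⟩ := hf
  funext τ
  have hdet : (D.sectionL g * η).1.mat.det.val = η.1.mat.det.val := by
    change (g.1.mat * η.1.mat).det.val = _
    rw [map_mul, Units.val_mul, integral_det, one_mul]
  have hmat : (D.sectionL g * η).1.mat • τ = g.1.mat • η.1.mat • τ := mul_smul g.1.mat η.1.mat τ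
  have hu : (D.sectionL g * η).2.2⁻¹.1 = η.2.2⁻¹.1 * (D.weilRep g)⁻¹.1 := by
    change ((D.weilRep g * η.2.2)⁻¹).1 = _
    rw [mul_inv_rev]; rfl
  have hphi : (D.sectionL g * η).1.phi τ = g.1.phi (η.1.mat • τ) * η.1.phi τ := rfl
  have hcancel : (D.weilRep g)⁻¹.1 * (D.weilRep g).1 = 1 :=
    congrArg Subtype.val (inv_mul_cancel (D.weilRep g))
  rw [slash, slash, hdet, hmat, hu, hphi, hf g, Matrix.mulVec_smul, Matrix.mulVec_mulVec, mul_assoc,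
    hcancel, mul_one, smul_smul, mul_zpow]
  congr 1
  rw [mul_assoc, mul_assoc, mul_comm (η.1.phi τ ^ (-κ)), ← mul_assoc (_ ^ (-κ)),
    ← zpow_add₀ (g.1.phi_ne_zero _)]
  simp

/-- The element of the ambient group acting through the operator `w` alone. -/
def twist (w : Matrix.unitaryGroup A ℂ) : D.Ambient := (1, 1, w)

theorem slash_mul_twist {κ : ℤ} {w : Matrix.unitaryGroup A ℂ} {ζ : ℂ} (hw : w.1 = ζ • 1)
    (η : D.Ambient) (f : ℍ → A → ℂ) :
    D.slash κ (η * D.twist w) f = ζ⁻¹ • D.slash κ η f := by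
  funext τ
  have h1 : w.1 * w⁻¹.1 = 1 := congrArg Subtype.val (mul_inv_cancel w)
  rw [hw, smul_mul_assoc, one_mul] at h1
  have hζ : ζ ≠ 0 := by
    rintro rfl
    have := congrFun (congrFun h1 0) 0
    simp at this
  have h2 : w⁻¹.1 = ζ⁻¹ • 1 := by rw [← h1, smul_smul, inv_mul_cancel₀ hζ, one_smul]
  have hfst : (η * D.twist w).1 = η.1 := mul_one η.1
  have hu : (η * D.twist w).2.2⁻¹.1 = ζ⁻¹ • η.2.2⁻¹.1 := by
    change ((η.2.2 * w)⁻¹).1 = _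
    rw [mul_inv_rev]
    change w⁻¹.1 * η.2.2⁻¹.1 = _
    rw [h2, smul_mul_assoc, one_mul]
  rw [Pi.smul_apply, slash, slash, hfst, hu, Matrix.smul_mulVec, smul_comm]

/-- If `uρ(g) = ζ ρ(g')u` and `αg = g'α`, then `ξ L(g)` and `L(g') ξ` differ by the central scalar
`ζ`. -/
theorem exists_twist {α : Metaplectic} {r : (ZMod D.level)ˣ} {u : Matrix.unitaryGroup A ℂ}
    {g g' : Metaplectic.integral} (hα : α * g.1 = g'.1 * α) {ζ : ℂ}
    (hu : u.1 * (D.weilRep g).1 = ζ • ((D.weilRep g').1 * u.1)) :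
    ∃ w : Matrix.unitaryGroup A ℂ, w.1 = ζ • 1 ∧ (∀ η, D.twist w * η = η * D.twist w) ∧
      ((α, r, u) : D.Ambient) * D.sectionL g = D.sectionL g' * (α, r, u) * D.twist w := by
  set w := u * D.weilRep g * (D.weilRep g' * u)⁻¹ with hw
  have hw1 : w.1 = ζ • 1 := by
    have h1 : (D.weilRep g').1 * u.1 * (D.weilRep g' * u)⁻¹.1 = 1 :=
      congrArg Subtype.val (mul_inv_cancel (D.weilRep g' * u))
    change u.1 * (D.weilRep g).1 * (D.weilRep g' * u)⁻¹.1 = _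
    rw [hu, smul_mul_assoc, h1]
  have hcomm : ∀ v : Matrix.unitaryGroup A ℂ, w * v = v * w := fun v => by
    apply Subtype.ext
    change w.1 * v.1 = v.1 * w.1
    rw [hw1, smul_mul_assoc, one_mul, mul_smul_comm, mul_one]
  refine ⟨w, hw1, fun η => ?_, ?_⟩
  · refine Prod.ext ?_ (Prod.ext ?_ (hcomm _))
    · exact (one_mul η.1).trans (mul_one η.1).symm
    · exact (one_mul η.2.1).trans (mul_one η.2.1).symm
  · refine Prod.ext ?_ (Prod.ext ?_ ?_)
    · exact hα.trans (mul_one _).symm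
    · change r * 1 = 1 * r * 1
      simp
    · change u * D.weilRep g = D.weilRep g' * u * w
      rw [← hcomm, hw, inv_mul_cancel_right]

theorem mk_eq_mk_iff {η θ : D.Ambient} :
    (Quotient.mk (QuotientGroup.rightRel D.Delta) η = Quotient.mk _ θ) ↔
      θ * η⁻¹ ∈ D.Delta := by
  rw [Quotient.eq, QuotientGroup.rightRel_apply]

theorem mk_mul_eq {δ : D.Ambient} (hδ : δ ∈ D.Delta) (η : D.Ambient) :
    Quotient.mk (QuotientGroup.rightRel D.Delta) (δ * η) = Quotient.mk _ η := by
  rw [mk_eq_mk_iff, mul_inv_rev, mul_inv_cancel_left]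
  exact inv_mem hδ

theorem slash_out {κ : ℤ} {f : ℍ → A → ℂ} (hf : f ∈ D.modularForms κ) (η : D.Ambient) :
    D.slash κ (Quotient.mk (QuotientGroup.rightRel D.Delta) η).out f = D.slash κ η f := by
  obtain ⟨g, hg⟩ := D.mk_eq_mk_iff.mp (Quotient.out_eq (Quotient.mk _ η))
  rw [← D.slash_sectionL_mul hf g (Quotient.mk _ η).out, hg, inv_mul_cancel_right]

/-- Right multiplication by a central scalar, as a map of cosets `Δη`. -/
def cosetTwist (w : Matrix.unitaryGroup A ℂ) :
    Quotient (QuotientGroup.rightRel D.Delta) → Quotient (QuotientGroup.rightRel D.Delta) :=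
  Quotient.map (· * D.twist w) fun a b hab => by
    have hab : QuotientGroup.rightRel D.Delta a b := hab
    change QuotientGroup.rightRel D.Delta _ _
    rw [QuotientGroup.rightRel_apply] at hab ⊢
    rwa [mul_inv_rev, mul_assoc, mul_inv_cancel_left]

/-- If some commutation relation `αg = g'α` lifts to `uρ(g) = ζ ρ(g')u` with `ζ ≠ 1`, then
multiplication by `ζ` permutes the cosets in `ΔξΔ`, so that the Hecke operator equals `ζ⁻¹` times
itself. -/
theorem hecke_eq_zero {α : Metaplectic} {r : (ZMod D.level)ˣ} {u : Matrix.unitaryGroup A ℂ}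
    (hfin : (D.heckeCosets (α, r, u)).Finite)
    {g g' : Metaplectic.integral} (hα : α * g.1 = g'.1 * α) {ζ : ℂ}
    (hu : u.1 * (D.weilRep g).1 = ζ • ((D.weilRep g').1 * u.1)) (hζ : ζ ≠ 1)
    {κ : ℤ} {f : ℍ → A → ℂ} (hf : f ∈ D.modularForms κ) :
    D.hecke κ (α, r, u) f = 0 := by
  obtain ⟨w, hw, hcomm, hξ⟩ := D.exists_twist (r := r) hα hu
  set ξ : D.Ambient := (α, r, u)
  have htw : D.twist w * D.twist w⁻¹ = 1 :=
    Prod.ext (mul_one _) (Prod.ext (mul_one _) (mul_inv_cancel w))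
  have htw' : D.twist w⁻¹ = (D.twist w)⁻¹ := eq_inv_of_mul_eq_one_right htw
  have hcomm' : ∀ η, D.twist w⁻¹ * η = η * D.twist w⁻¹ := fun η => by
    rw [htw', inv_mul_eq_iff_eq_mul, ← mul_assoc, hcomm, mul_inv_cancel_right]
  have hbij : Set.BijOn (D.cosetTwist w) (D.heckeCosets ξ) (D.heckeCosets ξ) := by
    refine Set.InvOn.bijOn (f' := D.cosetTwist w⁻¹) ⟨?_, ?_⟩ ?_ ?_
    · rintro - ⟨η, -, rfl⟩
      change Quotient.mk _ (η * D.twist w * D.twist w⁻¹) = _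
      rw [htw', mul_inv_cancel_right]
    · rintro - ⟨η, -, rfl⟩
      change Quotient.mk _ (η * D.twist w⁻¹ * D.twist w) = _
      rw [htw', inv_mul_cancel_right]
    · rintro - ⟨η, hη, rfl⟩
      obtain ⟨a, ha, b, hb, rfl⟩ := DoubleCoset.mem_doubleCoset.mp hη
      refine ⟨_, DoubleCoset.mem_doubleCoset.mpr ⟨a * (D.sectionL g')⁻¹, ?_, D.sectionL g * b, ?_,
        ?_⟩, rfl⟩
      · exact mul_mem ha (inv_mem ⟨g', rfl⟩)
      · exact mul_mem ⟨g, rfl⟩ hb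
      · change a * ξ * b * D.twist w = _
        have : a * (D.sectionL g')⁻¹ * ξ * (D.sectionL g * b) =
            a * (D.sectionL g')⁻¹ * (ξ * D.sectionL g) * b := by simp only [mul_assoc]
        rw [this, hξ]
        simp only [mul_assoc, inv_mul_cancel_left, hcomm]
    · rintro - ⟨η, hη, rfl⟩
      obtain ⟨a, ha, b, hb, rfl⟩ := DoubleCoset.mem_doubleCoset.mp hη
      refine ⟨_, DoubleCoset.mem_doubleCoset.mpr ⟨a * D.sectionL g', ?_, (D.sectionL g)⁻¹ * b, ?_,
        ?_⟩, rfl⟩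
      · exact mul_mem ha ⟨g', rfl⟩
      · exact mul_mem (inv_mem ⟨g, rfl⟩) hb
      · change a * ξ * b * D.twist w⁻¹ = _
        have h1 : ξ = D.sectionL g' * ξ * D.twist w * (D.sectionL g)⁻¹ := by
          rw [← hξ, mul_inv_cancel_right]
        have h2 : ξ * D.twist w⁻¹ = D.sectionL g' * ξ * (D.sectionL g)⁻¹ := by
          conv_lhs => rw [h1]
          rw [mul_assoc, ← hcomm', mul_assoc, ← mul_assoc (D.twist w), htw, one_mul]
        rw [mul_assoc, ← hcomm', ← mul_assoc, mul_assoc a, h2]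
        simp only [mul_assoc]
  have hsum := finsum_mem_eq_of_bijOn (f := fun c => ζ⁻¹ • D.slash κ c.out f)
    (g := fun c => D.slash κ c.out f) _ hbij (by
      rintro - ⟨η, -, rfl⟩
      change ζ⁻¹ • D.slash κ _ f =
        D.slash κ (Quotient.mk (QuotientGroup.rightRel D.Delta) (η * D.twist w)).out f
      rw [D.slash_out hf, D.slash_out hf, D.slash_mul_twist hw])
  rw [← smul_finsum_mem hfin] at hsum
  rw [hecke]
  set X := ∑ᶠ c ∈ D.heckeCosets ξ, D.slash κ c.out f
  have h0 : (ζ⁻¹ - 1) • X = 0 := by rw [sub_smul, hsum, one_smul, sub_self]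
  rcases smul_eq_zero.mp h0 with h | h
  · exact absurd (by rw [← inv_inv ζ, sub_eq_zero.mp h, inv_one]) hζ
  · rw [h, smul_zero]

/-! ### Conjugation by elements of `𝒬₂(N)` -/

theorem mul_mapGL_eq_iff {N : ℕ} {M : GL (Fin 2) ℝ} {n : ℤ} {B : Matrix (Fin 2) (Fin 2) ℤ}
    (h : IsIntegralMultiple N M n B) (γ γ' : SL(2, ℤ)) :
    M * Matrix.SpecialLinearGroup.mapGL ℝ γ = Matrix.SpecialLinearGroup.mapGL ℝ γ' * M ↔
      B * γ.1 = γ'.1 * B := by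
  obtain ⟨hn, -, -, hB⟩ := h
  have hn' : (n : ℝ) ≠ 0 := by exact_mod_cast hn
  have hval : ∀ δ : SL(2, ℤ), (Matrix.SpecialLinearGroup.mapGL ℝ δ).val =
      δ.1.map (Int.castRingHom ℝ) := fun δ => rfl
  have hB' : (n : ℝ) • M.val = B.map (Int.castRingHom ℝ) := hB
  rw [Units.ext_iff, Units.val_mul, Units.val_mul, hval, hval,
    ← (smul_right_injective _ hn').eq_iff]
  change (n : ℝ) • (_ * _) = (n : ℝ) • (_ * _) ↔ _
  rw [← smul_mul_assoc, ← mul_smul_comm, hB', ← Matrix.map_mul, ← Matrix.map_mul]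
  exact (Matrix.map_injective (Int.cast_injective (α := ℝ))).eq_iff

theorem mul_eq_mul_iff_toSL {N : ℕ} {α : Metaplectic} {n : ℤ} {B : Matrix (Fin 2) (Fin 2) ℤ}
    (h : IsIntegralMultiple N α.mat n B) {g g' : Metaplectic.integral} (hα : α * g.1 = g'.1 * α) :
    B * (Metaplectic.toSL g).1 = (Metaplectic.toSL g').1 * B := by
  rw [← mul_mapGL_eq_iff h, Metaplectic.mapGL_toSL, Metaplectic.mapGL_toSL]
  exact congrArg Metaplectic.mat hα

theorem det_ne_zero_of_isIntegralMultiple {N : ℕ} {α : Metaplectic} {n : ℤ}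
    {B : Matrix (Fin 2) (Fin 2) ℤ} (h : IsIntegralMultiple N α.mat n B) :
    (B.det : ℝ) = n ^ 2 * α.mat.det.val ∧ 0 < B.det := by
  obtain ⟨hn, -, -, hB⟩ := h
  have hn' : (n : ℝ) ≠ 0 := by exact_mod_cast hn
  have h1 : (B.det : ℝ) = n ^ 2 * α.mat.det.val := by
    have h2 := congrArg Matrix.det hB
    rw [Matrix.det_smul, Fintype.card_fin] at h2
    rw [Matrix.GeneralLinearGroup.val_det_apply, h2]
    exact (Int.castRingHom ℝ).map_det B
  refine ⟨h1, ?_⟩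
  have h3 : (0 : ℝ) < B.det := by
    rw [h1]
    exact mul_pos (by positivity) α.det_pos
  exact_mod_cast h3

/-- Elements of the principal congruence subgroup of level `det B` are conjugated by `α` into
`Mp₂(ℤ)`. -/
theorem exists_conj_of_congr_one {N : ℕ} {α : Metaplectic} {n : ℤ} {B : Matrix (Fin 2) (Fin 2) ℤ}
    (h : IsIntegralMultiple N α.mat n B) {g : Metaplectic.integral}
    (hg : ∀ i j, B.det ∣ (Metaplectic.toSL g).1 i j - (1 : Matrix (Fin 2) (Fin 2) ℤ) i j) :
    ∃ g' : Metaplectic.integral, α * g.1 = g'.1 * α := by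
  choose X hX using hg
  have hX' : (Metaplectic.toSL g).1 = 1 + B.det • Matrix.of X := by
    ext i j
    have := hX i j
    simp only [Matrix.add_apply, Matrix.smul_apply, Matrix.of_apply, smul_eq_mul]
    linarith
  have hB0 : B.det ≠ 0 := (det_ne_zero_of_isIntegralMultiple h).2.ne'
  set Y := 1 + B * Matrix.of X * B.adjugate with hY
  have hYB : B * (Metaplectic.toSL g).1 = Y * B := by
    rw [hX', hY, mul_add, mul_one, add_mul, one_mul, mul_assoc (B * _), Matrix.adjugate_mul,
      mul_smul_comm, mul_smul_comm, mul_one]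
  have hdet : Y.det = 1 := by
    have h1 := congrArg Matrix.det hYB
    rw [Matrix.det_mul, Matrix.det_mul, (Metaplectic.toSL g).2, mul_one] at h1
    exact mul_right_cancel₀ hB0 (by rw [← h1, one_mul])
  have h2 := (mul_mapGL_eq_iff h (Metaplectic.toSL g) ⟨Y, hdet⟩).mpr hYB
  rw [Metaplectic.mapGL_toSL] at h2
  refine ⟨⟨α * g.1 * α⁻¹, ⟨⟨Y, hdet⟩, ?_⟩⟩, by rw [inv_mul_cancel_right]⟩
  change _ = α.mat * g.1.mat * α.mat⁻¹
  rw [h2, mul_inv_cancel_right]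

/-- The elements of `𝒬₂(N)` in terms of an integral multiple `B` of the matrix: up to scalars the
operator is `ρ_A(g₀)`, with `g₀` congruent to a multiple of `B`. -/
theorem exists_of_mem_groupQ2 {α : Metaplectic} {r : (ZMod D.level)ˣ}
    {u : Matrix.unitaryGroup A ℂ} (h : (α, r, u) ∈ D.groupQ2) :
    ∃ (n : ℤ) (B : Matrix (Fin 2) (Fin 2) ℤ) (g₀ : Metaplectic.integral) (s : (ZMod D.level)ˣ)
      (c : ℂ), IsIntegralMultiple D.level α.mat n B ∧
      B.map (Int.castRingHom (ZMod D.level)) =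
        (s : ZMod D.level) • (Metaplectic.toSL g₀).1.map (Int.castRingHom (ZMod D.level)) ∧
      u.1 = c • (D.weilRep g₀).1 := by
  obtain ⟨-, R, ⟨n, B, hB, hnR⟩, -, γ, g₀, hg₀, hR, ε, -, hu⟩ := h
  have hn : IsUnit (n : ZMod D.level) := (ZMod.coe_int_isUnit_iff_isCoprime n D.level).mpr hB.2.1.symm
  refine ⟨n, B, g₀, hn.unit * r, _, hB, ?_, hu⟩
  rw [Metaplectic.toSL_eq hg₀, Units.val_mul, IsUnit.unit_spec, mul_smul]
  exact hnR.symm.trans (by rw [hR]; rfl)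

theorem exists_weilRep_mul_eq_smul {α : Metaplectic} {n : ℤ}
    {B : Matrix (Fin 2) (Fin 2) ℤ}
    (hB : IsIntegralMultiple D.level α.mat n B) {g₀ : Metaplectic.integral} {s : (ZMod D.level)ˣ}
    (hs : B.map (Int.castRingHom (ZMod D.level)) =
        (s : ZMod D.level) • (Metaplectic.toSL g₀).1.map (Int.castRingHom (ZMod D.level)))
    {g g' : Metaplectic.integral} (hα : α * g.1 = g'.1 * α) :
    ∃ ζ : ℂ, (D.weilRep (g₀ * g)).1 = ζ • (D.weilRep (g' * g₀)).1 := by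
  refine D.exists_weilRep_eq_smul ?_
  have h1 := congrArg (fun X => X.map (Int.castRingHom (ZMod D.level))) (mul_eq_mul_iff_toSL hB hα)
  simp only [Matrix.map_mul, hs, smul_mul_assoc, mul_smul_comm] at h1
  have h2 := congrArg (fun X => (s⁻¹ : (ZMod D.level)ˣ).val • X) h1
  simp only [smul_smul, Units.inv_mul, one_smul] at h2
  rw [Metaplectic.toSL_mul_val, Metaplectic.toSL_mul_val]
  rw [← Matrix.map_mul, ← Matrix.map_mul] at h2
  exact h2.symm

theorem mul_weilRep_eq_smul {u : Matrix.unitaryGroup A ℂ} {c ζ : ℂ}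
    {g₀ g g' : Metaplectic.integral} (hu : u.1 = c • (D.weilRep g₀).1)
    (hζ : (D.weilRep (g₀ * g)).1 = ζ • (D.weilRep (g' * g₀)).1) :
    u.1 * (D.weilRep g).1 = ζ • ((D.weilRep g').1 * u.1) := by
  rw [hu, smul_mul_assoc, ← weilRep_mul_val, hζ, mul_smul_comm, ← weilRep_mul_val, smul_comm]

theorem pow_eq_one_of_weilRep {ζ : ℂ} {g g' : Metaplectic.integral} {u : Matrix.unitaryGroup A ℂ}
    (h : u.1 * (D.weilRep g).1 = ζ • ((D.weilRep g').1 * u.1)) :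
    ζ ^ (Fintype.card A * (8 * D.level)) = 1 := by
  have hu : u.1.det ≠ 0 := by
    have h1 := congrArg Matrix.det (congrArg Subtype.val (mul_inv_cancel u))
    change (u.1 * u⁻¹.1).det = Matrix.det 1 at h1
    rw [Matrix.det_mul, Matrix.det_one] at h1
    exact left_ne_zero_of_mul_eq_one h1
  have h1 := congrArg (fun X => Matrix.det X ^ (8 * D.level)) h
  simp only [Matrix.det_mul, Matrix.det_smul, mul_pow, weilRep_det_pow] at h1
  rw [mul_one, one_mul, ← pow_mul] at h1
  exact (mul_right_cancel₀ (pow_ne_zero _ hu) ((one_mul _).trans h1)).symm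

/-- The double coset `ΔξΔ` contains only finitely many cosets `Δη`: modulo `det B` there are
finitely many classes in `Mp₂(ℤ)`, and the scalars that arise are roots of unity of bounded
order. -/
theorem heckeCosets_finite {α : Metaplectic} {r : (ZMod D.level)ˣ}
    {u : Matrix.unitaryGroup A ℂ} (h : (α, r, u) ∈ D.groupQ2) :
    (D.heckeCosets (α, r, u)).Finite := by
  classical
  obtain ⟨n, B, g₀, s, c, hB, hs, hu⟩ := D.exists_of_mem_groupQ2 h
  obtain ⟨m, hm⟩ := Int.eq_ofNat_of_zero_le (det_ne_zero_of_isIntegralMultiple hB).2.le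
  have hm0 : m ≠ 0 := by
    have := (det_ne_zero_of_isIntegralMultiple hB).2
    omega
  have : NeZero m := ⟨hm0⟩
  let red : Metaplectic.integral → Matrix (Fin 2) (Fin 2) (ZMod m) := fun g =>
    (Metaplectic.toSL g).1.map (Int.castRingHom (ZMod m))
  let rep : Matrix (Fin 2) (Fin 2) (ZMod m) → Metaplectic.integral := Function.invFun red
  let K := Fintype.card A * (8 * D.level)
  have hK : 0 < K := Nat.mul_pos Fintype.card_pos (Nat.mul_pos (by norm_num) D.level_spec.1)
  let W : Set (Matrix.unitaryGroup A ℂ) := {w | ∃ ζ : ℂ, ζ ^ K = 1 ∧ w.1 = ζ • 1}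
  have hW : W.Finite := by
    have h1 : {ζ : ℂ | ζ ^ K = 1}.Finite := by
      refine (Polynomial.nthRoots K (1 : ℂ)).toFinset.finite_toSet.subset fun ζ hζ => ?_
      simpa [Polynomial.mem_nthRoots hK] using hζ
    refine ((h1.image fun ζ => ζ • (1 : Matrix A A ℂ)).preimage
      Subtype.val_injective.injOn).subset ?_
    rintro w ⟨ζ, hζ, hw⟩
    exact ⟨ζ, hζ, hw.symm⟩
  let F : Matrix (Fin 2) (Fin 2) (ZMod m) × Matrix.unitaryGroup A ℂ →
      Quotient (QuotientGroup.rightRel D.Delta) := fun p =>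
    Quotient.mk _ (D.twist p.2 * ((α, r, u) * D.sectionL (rep p.1)))
  refine ((Set.finite_univ.prod hW).image F).subset ?_
  rintro - ⟨η, hη, rfl⟩
  obtain ⟨a, ha, -, ⟨g, rfl⟩, rfl⟩ := DoubleCoset.mem_doubleCoset.mp hη
  have hrep : red (rep (red g)) = red g := Function.invFun_eq ⟨g, rfl⟩
  set g₁ := rep (red g) with hg₁
  have hone : (Metaplectic.toSL (g * g₁⁻¹)).1.map (Int.castRingHom (ZMod m)) = 1 := by
    have h1 : (Metaplectic.toSL g).1.map (Int.castRingHom (ZMod m)) =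
      (Metaplectic.toSL g₁).1.map (Int.castRingHom (ZMod m)) := hrep.symm
    rw [Metaplectic.toSL_mul_val, Matrix.map_mul, h1, ← Matrix.map_mul,
      Metaplectic.toSL_mul_toSL_inv]
    exact Matrix.map_one _ (map_zero _) (map_one _)
  obtain ⟨h', hh'⟩ := exists_conj_of_congr_one hB (g := g * g₁⁻¹) fun i j => by
    have h1 := congrFun (congrFun hone i) j
    rw [hm]
    change (m : ℤ) ∣ _
    rw [← ZMod.intCast_zmod_eq_zero_iff_dvd, Int.cast_sub, sub_eq_zero]
    refine Eq.trans h1 ?_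
    simp [Matrix.one_apply]
  obtain ⟨ζ, hζ⟩ := D.exists_weilRep_mul_eq_smul hB hs hh'
  have hζ' := D.mul_weilRep_eq_smul hu hζ
  obtain ⟨w, hw, hcomm, hξ⟩ := D.exists_twist (r := r) hh' hζ'
  refine ⟨(red g, w), ⟨Set.mem_univ _, ⟨ζ, D.pow_eq_one_of_weilRep hζ', hw⟩⟩, ?_⟩
  change Quotient.mk _ (D.twist w * ((α, r, u) * D.sectionL g₁)) = _
  have hg : D.sectionL g = D.sectionL (g * g₁⁻¹) * D.sectionL g₁ := by
    rw [← map_mul, inv_mul_cancel_right]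
  have hfin : a * (α, r, u) * D.sectionL g =
      a * D.sectionL h' * (D.twist w * ((α, r, u) * D.sectionL g₁)) := by
    rw [hg, ← mul_assoc (a * _), mul_assoc a, hξ, ← mul_assoc (D.twist w), hcomm]
    simp only [mul_assoc]
  rw [hfin, D.mk_mul_eq (mul_mem ha ⟨h', rfl⟩)]

end

end DiscriminantForm

/-! ### The vanishing theorem -/

namespace DiscriminantForm

open scoped MatrixGroups UpperHalfPlane Manifold
open UpperHalfPlane

noncomputable section

variable {A : Type*} [AddCommGroup A] [Fintype A] [DecidableEq A] (D : DiscriminantForm A)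

/-- For diagonal reduction of `g₀` the relation `ρ(g₀)ρ(g) = ρ(g')ρ(g₀)` forces the entries of
`ρ(g)` and `ρ(g')` at `(0, 0)` to agree. -/
theorem weilRep_apply_zero_eq {g₀ g g' : Metaplectic.integral}
    (h01 : ((Metaplectic.toSL g₀).1 0 1 : ZMod D.level) = 0)
    (h10 : ((Metaplectic.toSL g₀).1 1 0 : ZMod D.level) = 0)
    (h : D.weilRep (g₀ * g) = D.weilRep (g' * g₀)) :
    (D.weilRep g).1 0 0 = (D.weilRep g').1 0 0 := by
  have hrow : ∀ M : Matrix A A ℂ,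
      ((D.weilRep g₀).1 * M) 0 0 = (D.weilRep g₀).1 0 0 * M 0 0 := fun M => by
    rw [Matrix.mul_apply]
    refine Finset.sum_eq_single 0 (fun z _ hz => ?_) (by simp)
    rw [(D.weilRep_apply_zero h01 h10 hz).1, zero_mul]
  have hcol : ∀ M : Matrix A A ℂ,
      (M * (D.weilRep g₀).1) 0 0 = M 0 0 * (D.weilRep g₀).1 0 0 := fun M => by
    rw [Matrix.mul_apply]
    refine Finset.sum_eq_single 0 (fun z _ hz => ?_) (by simp)
    rw [(D.weilRep_apply_zero h01 h10 hz).2, mul_zero]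
  have h0 : (D.weilRep g₀).1 0 0 ≠ 0 := by
    have h1 := hrow (D.weilRep g₀⁻¹).1
    rw [weilRep_mul_weilRep_inv, Matrix.one_apply_eq] at h1
    exact left_ne_zero_of_mul_eq_one h1.symm
  have h1 := congrFun (congrFun (congrArg Subtype.val h) 0) 0
  rw [weilRep_mul_val, weilRep_mul_val, hrow, hcol, mul_comm] at h1
  exact mul_right_cancel₀ h0 h1

/-- For `α` over a multiple of `diag(m, 1)`, and `x` with `x ≡ -1 mod N` and `xy = mᵏ + 1`, the lift
`S Tˣ S Tʸ S` of `(-y, 1; mᵏ, -x)` is conjugated by `αᵏ` into `T⁻ʸ S T⁻ˣ`, through elements of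
`Mp₂(ℤ)`. If conjugation by `α` were compatible with the Weil representation, both would have the
same entry at `(0, 0)`, and the Gauss sum of `A` would have a real square. -/
theorem conj_gaussSum_sq_of_forall_weilRep_eq {α : Metaplectic} {c : ℝ} {m x k : ℕ} {t : ℤ}
    (hm : 0 < m)
    (hα : (α.mat : Matrix (Fin 2) (Fin 2) ℝ) = !![c * m, 0; 0, c]) {g₀ : Metaplectic.integral}
    (h01 : ((Metaplectic.toSL g₀).1 0 1 : ZMod D.level) = 0)
    (h10 : ((Metaplectic.toSL g₀).1 1 0 : ZMod D.level) = 0)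
    (hcomm : ∀ g g' : Metaplectic.integral, α * g.1 = g'.1 * α →
      D.weilRep (g₀ * g) = D.weilRep (g' * g₀))
    (ht : IsUnit (t : ZMod D.level)) (hmt : (m : ZMod D.level) = (t : ZMod D.level) ^ 2)
    (hx : D.level ∣ x + 1) (hxm : x ∣ m ^ k + 1) :
    (starRingEnd ℂ) (D.gaussSum 1) ^ 2 = D.gaussSum 1 ^ 2 := by
  obtain ⟨y, hxy⟩ := hxm
  set s : Metaplectic.integral := ⟨Metaplectic.S, Metaplectic.S_mem⟩ with hs
  set T : Metaplectic.integral := ⟨Metaplectic.T, Metaplectic.T_mem⟩ with hT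
  set h₀ : Metaplectic.integral := s * T ^ x * s * T ^ y * s with hh₀
  have hh₀' : h₀.1 = Metaplectic.S * Metaplectic.T ^ x * Metaplectic.S * Metaplectic.T ^ y *
    Metaplectic.S := rfl
  have hxyR : (x * y : ℝ) = (m : ℝ) ^ k + 1 := by exact_mod_cast hxy.symm
  have hxyZ : (x * y : ℤ) = (m : ℤ) ^ k + 1 := by exact_mod_cast hxy.symm
  -- the successive conjugates of `h₀` by `α`
  have hconj : ∀ i, i ≤ k → ∃ h : Metaplectic.integral, h.1 = α ^ i * h₀.1 * (α ^ i)⁻¹ ∧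
      (h.1.mat : Matrix (Fin 2) (Fin 2) ℝ) =
        !![-(y : ℝ), (m : ℝ) ^ i; (m : ℝ) ^ (k - i), -(x : ℝ)] ∧
      (D.weilRep h).1 0 0 = (D.weilRep h₀).1 0 0 := by
    intro i
    induction i with
    | zero =>
      intro _
      refine ⟨h₀, by simp, ?_, rfl⟩
      simp only [hh₀', Metaplectic.mul_mat, Units.val_mul, Metaplectic.S_mat,
        Metaplectic.T_pow_mat, Nat.sub_zero, pow_zero]
      ext i j
      fin_cases i <;> fin_cases j <;> simp
      linarith
    | succ i ih =>
      intro hi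
      obtain ⟨h, h1, h2, h3⟩ := ih (by omega)
      have hpow : (m : ℝ) ^ (k - i) = m ^ (k - (i + 1)) * m := by
        rw [← pow_succ]; congr 1; omega
      have hpow' : (m : ℤ) ^ k = m ^ (i + 1) * m ^ (k - (i + 1)) := by
        rw [← pow_add]; congr 1; omega
      let γ : SL(2, ℤ) := ⟨!![-(y : ℤ), (m : ℤ) ^ (i + 1); (m : ℤ) ^ (k - (i + 1)), -(x : ℤ)], by
        rw [Matrix.det_fin_two_of, ← hpow']; linarith⟩
      have hγ : (Matrix.SpecialLinearGroup.mapGL ℝ γ).val =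
          !![-(y : ℝ), (m : ℝ) ^ (i + 1); (m : ℝ) ^ (k - (i + 1)), -(x : ℝ)] := by
        ext a b
        change ((γ.1 a b : ℤ) : ℝ) = _
        fin_cases a <;> fin_cases b <;> simp [γ]
      have hmat : Matrix.SpecialLinearGroup.mapGL ℝ γ = α.mat * h.1.mat * α.mat⁻¹ := by
        rw [eq_mul_inv_iff_mul_eq]
        apply Units.ext
        rw [Units.val_mul, Units.val_mul, hγ, hα, h2]
        ext a b
        fin_cases a <;> fin_cases b <;> simp [hpow] <;> ring
      let h' : Metaplectic.integral := ⟨α * h.1 * α⁻¹, ⟨γ, hmat⟩⟩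
      have hαh : α * h.1 = h'.1 * α := by
        change _ = α * h.1 * α⁻¹ * α
        rw [inv_mul_cancel_right]
      refine ⟨h', ?_, ?_, ?_⟩
      · change α * h.1 * α⁻¹ = _
        rw [h1, pow_succ', mul_inv_rev]
        simp only [mul_assoc]
      · rw [← hγ, hmat]; rfl
      · rw [← h3]
        exact (D.weilRep_apply_zero_eq h01 h10 (hcomm _ _ hαh)).symm
  obtain ⟨h, h1, -, h3⟩ := hconj k le_rfl
  have hαk : ((α ^ k).mat : Matrix (Fin 2) (Fin 2) ℝ) = !![c ^ k * (m : ℝ) ^ k, 0; 0, c ^ k] := by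
    clear hconj h1 h3 hxyR hxyZ hxy
    induction k with
    | zero => simp [Matrix.one_fin_two]
    | succ k ih =>
      rw [pow_succ, Metaplectic.mul_mat, Units.val_mul, ih, hα]
      ext a b
      fin_cases a <;> fin_cases b <;> simp <;> ring
  have hfin : T ^ y * h * T ^ x = s := by
    apply Subtype.ext
    change Metaplectic.T ^ y * h.1 * Metaplectic.T ^ x = Metaplectic.S
    rw [h1, hh₀']
    exact Metaplectic.T_pow_mul_conj_mul_T_pow (by positivity) hαk hxyR
  have hx' : (x : ZMod D.level) = -1 := by
    have := (ZMod.natCast_eq_zero_iff (x + 1) D.level).mpr hx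
    push_cast at this
    exact eq_neg_of_add_eq_zero_left this
  have hy' : (y : ZMod D.level) = -(1 + ((t ^ k : ℤ) : ZMod D.level) ^ 2) := by
    have h4 := congrArg (fun a : ℕ => (a : ZMod D.level)) hxy
    push_cast at h4 ⊢
    rw [hx', hmt] at h4
    linear_combination h4
  have e1 := D.weilRep_T_pow_mul_mul_apply_zero h y x
  rw [← hT, hfin, hs, weilRep_S_apply_zero, h3, hh₀,
    D.weilRep_STSTS_apply_zero hx' hy' (by push_cast; exact ht.pow k)] at e1
  have e2 := D.weilConst_mul_sum
  rw [← gaussSum_one] at e2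
  set g := D.gaussSum 1
  set g' := (starRingEnd ℂ) g
  set w := D.weilConst
  calc g' ^ 2 = (w * g) ^ 3 * g' ^ 2 := by rw [e2]; ring
    _ = (w ^ 3 * g' ^ 2) * g ^ 3 := by ring
    _ = (w * g) * g ^ 2 := by rw [← e1]; ring
    _ = g ^ 2 := by rw [e2, one_mul]

/-- If `det α` is not a rational square, conjugation by `α` is incompatible with the Weil
representation: some relation `αg = g'α` does not lift to `ρ(g₀)ρ(g) = ρ(g')ρ(g₀)`. -/
theorem exists_weilRep_mul_ne (hodd : Odd D.signature) {α : Metaplectic} {n : ℤ}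
    {B : Matrix (Fin 2) (Fin 2) ℤ} (hB : IsIntegralMultiple D.level α.mat n B)
    {g₀ : Metaplectic.integral} {s : (ZMod D.level)ˣ}
    (hs : B.map (Int.castRingHom (ZMod D.level)) =
        (s : ZMod D.level) • (Metaplectic.toSL g₀).1.map (Int.castRingHom (ZMod D.level)))
    (hsq : ¬ ∃ q : ℚ, α.mat.det.val = (q : ℝ) ^ 2) :
    ∃ g g' : Metaplectic.integral, α * g.1 = g'.1 * α ∧
      D.weilRep (g₀ * g) ≠ D.weilRep (g' * g₀) := by
  by_contra! hcomm
  have hn : (n : ℝ) ≠ 0 := by exact_mod_cast hB.1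
  have h4 := D.four_dvd_level hodd
  obtain ⟨hdet, hBpos⟩ := det_ne_zero_of_isIntegralMultiple hB
  obtain ⟨γ₁, γ₂, c, m', hm', hc, hBeq⟩ := Matrix.exists_eq_SL_mul_diagonal_mul_SL hBpos
  obtain ⟨m, rfl⟩ := Int.eq_ofNat_of_zero_le hm'.le
  have hBdet : B.det = c * c * m := by
    rw [hBeq, Matrix.det_mul, Matrix.det_mul, γ₁.2, γ₂.2, Matrix.det_fin_two_of]
    push_cast
    ring
  obtain ⟨d₁, hd₁⟩ := Metaplectic.toSL_surjective γ₁
  obtain ⟨d₂, hd₂⟩ := Metaplectic.toSL_surjective γ₂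
  -- replacing `α` by a diagonal element of the same double coset
  set β : Metaplectic := d₁⁻¹.1 * α * d₂⁻¹.1 with hβ
  set b₀ := d₁⁻¹ * g₀ * d₂⁻¹ with hb₀
  have hαβ : α = d₁.1 * β * d₂.1 := by
    rw [hβ]
    change α = d₁.1 * (d₁.1⁻¹ * α * d₂.1⁻¹) * d₂.1
    group
  have hcomm' : ∀ g g' : Metaplectic.integral, β * g.1 = g'.1 * β →
      D.weilRep (b₀ * g) = D.weilRep (g' * b₀) := by
    intro g g' hg
    have h1 := hcomm (d₂⁻¹ * g * d₂) (d₁ * g' * d₁⁻¹) (by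
      change α * (d₂.1⁻¹ * g.1 * d₂.1) = (d₁.1 * g'.1 * d₁.1⁻¹) * α
      rw [hαβ]
      calc d₁.1 * β * d₂.1 * (d₂.1⁻¹ * g.1 * d₂.1) = d₁.1 * (β * g.1) * d₂.1 := by group
        _ = _ := by rw [hg]; group)
    have h2 : b₀ * g = d₁⁻¹ * (g₀ * (d₂⁻¹ * g * d₂)) * d₂⁻¹ := by rw [hb₀]; group
    have h3 : g' * b₀ = d₁⁻¹ * (d₁ * g' * d₁⁻¹ * g₀) * d₂⁻¹ := by rw [hb₀]; group
    rw [h2, h3, map_mul D.weilRep _ d₂⁻¹, map_mul D.weilRep d₁⁻¹ _, h1, ← map_mul, ← map_mul]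
  have hval : ∀ g : Metaplectic.integral, (g.1.mat : Matrix (Fin 2) (Fin 2) ℝ) =
      (Metaplectic.toSL g).1.map (Int.castRingHom ℝ) := fun g => by
    rw [← Metaplectic.mapGL_toSL]; rfl
  have hsl : ∀ d : Metaplectic.integral, (Metaplectic.toSL d⁻¹).1 * (Metaplectic.toSL d).1 = 1 :=
    fun d => by simpa using Metaplectic.toSL_mul_toSL_inv d⁻¹
  have hdiag : (Metaplectic.toSL d₁⁻¹).1 * B * (Metaplectic.toSL d₂⁻¹).1 = !![c * m, 0; 0, c] := by
    rw [hBeq, ← hd₁, ← hd₂]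
    calc _ = ((Metaplectic.toSL d₁⁻¹).1 * (Metaplectic.toSL d₁).1) * !![c * (m : ℤ), 0; 0, c] *
          ((Metaplectic.toSL d₂).1 * (Metaplectic.toSL d₂⁻¹).1) := by simp only [Matrix.mul_assoc]
      _ = _ := by rw [hsl, Metaplectic.toSL_mul_toSL_inv, Matrix.one_mul, Matrix.mul_one]
  have hβmat : (β.mat : Matrix (Fin 2) (Fin 2) ℝ) = !![(c / n : ℝ) * m, 0; 0, (c / n : ℝ)] := by
    have h1 : (n : ℝ) • (β.mat : Matrix (Fin 2) (Fin 2) ℝ) =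
        (!![c * m, 0; 0, c] : Matrix (Fin 2) (Fin 2) ℤ).map (Int.castRingHom ℝ) := by
      have hB' : (n : ℝ) • α.mat.val = B.map (Int.castRingHom ℝ) := hB.2.2.2
      rw [← hdiag, Matrix.map_mul, Matrix.map_mul, ← hB', ← hval, ← hval, mul_smul_comm,
        smul_mul_assoc]
      rfl
    ext i j
    have h2 := congrFun (congrFun h1 i) j
    rw [Matrix.smul_apply, smul_eq_mul] at h2
    rw [← mul_right_inj' hn, h2]
    fin_cases i <;> fin_cases j <;> simp <;> field_simp
  have hred : (!![c * m, 0; 0, c] : Matrix (Fin 2) (Fin 2) ℤ).map (Int.castRingHom (ZMod D.level)) =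
      (s : ZMod D.level) • (Metaplectic.toSL b₀).1.map (Int.castRingHom (ZMod D.level)) := by
    rw [← hdiag, Matrix.map_mul, Matrix.map_mul, hs, hb₀, Metaplectic.toSL_mul_val,
      Metaplectic.toSL_mul_val, Matrix.map_mul, Matrix.map_mul, mul_smul_comm, smul_mul_assoc]
  have hentry : ∀ i j, (((!![c * m, 0; 0, c] : Matrix (Fin 2) (Fin 2) ℤ) i j : ℤ) : ZMod D.level) =
      s * ((Metaplectic.toSL b₀).1 i j : ZMod D.level) := fun i j =>
    congrFun (congrFun hred i) j
  have h01 : ((Metaplectic.toSL b₀).1 0 1 : ZMod D.level) = 0 := by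
    have := hentry 0 1
    simpa using this.symm
  have h10 : ((Metaplectic.toSL b₀).1 1 0 : ZMod D.level) = 0 := by
    have := hentry 1 0
    simpa using this.symm
  have hbdet : ((Metaplectic.toSL b₀).1 0 0 : ZMod D.level) * (Metaplectic.toSL b₀).1 1 1 = 1 := by
    have h1 := congrArg (fun a : ℤ => (a : ZMod D.level))
      ((Matrix.det_fin_two _).symm.trans (Metaplectic.toSL b₀).2)
    push_cast at h1
    rwa [h01, zero_mul, sub_zero] at h1
  -- the square root of `m` modulo `N`
  obtain ⟨t, ht⟩ := ZMod.intCast_surjective ((Metaplectic.toSL b₀).1 0 0 : ZMod D.level)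
  have htu : IsUnit (t : ZMod D.level) := by rw [ht]; exact IsUnit.of_mul_eq_one _ hbdet
  have hmt : (m : ZMod D.level) = (t : ZMod D.level) ^ 2 := by
    have h1 := hentry 0 0
    have h2 := hentry 1 1
    simp at h1 h2
    rw [ht]
    have h3 : (s : ZMod D.level) * ((Metaplectic.toSL b₀).1 1 1 * m) =
        s * (Metaplectic.toSL b₀).1 0 0 := by rw [← mul_assoc, ← h2, h1]
    have h5 := s.isUnit.mul_left_cancel h3
    calc (m : ZMod D.level) = ((Metaplectic.toSL b₀).1 0 0 * (Metaplectic.toSL b₀).1 1 1) * m := by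
          rw [hbdet, one_mul]
      _ = (Metaplectic.toSL b₀).1 0 0 * ((Metaplectic.toSL b₀).1 1 1 * m) := mul_assoc _ _ _
      _ = _ := by rw [h5, pow_two]
  have hcop : Nat.Coprime D.level m := by
    have : IsUnit (m : ZMod D.level) := by rw [hmt]; exact htu.pow 2
    exact ((ZMod.isUnit_iff_coprime m D.level).mp this).symm
  have hm4 : m % 4 = 1 := by
    have h1 : (D.level : ℤ) ∣ m - t * t := by
      rw [← D.intCast_eq_iff_dvd]
      push_cast
      rw [hmt, pow_two]
    have h2 : (4 : ℤ) ∣ m - t * t := (Int.natCast_dvd_natCast.mpr h4).trans h1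
    have h3 : m % 2 = 1 := Nat.odd_iff.mp (Nat.coprime_two_left.mp
      (Nat.Coprime.coprime_dvd_left ((by norm_num : 2 ∣ 4).trans h4) hcop))
    rcases Int.even_or_odd' t with ⟨a, rfl | rfl⟩
    · ring_nf at h2
      omega
    · ring_nf at h2
      omega
  have hmsq : ¬ IsSquare m := by
    rintro ⟨a, rfl⟩
    refine hsq ⟨c * a / n, ?_⟩
    have h1 : (n : ℝ) ^ 2 * α.mat.det.val = c * c * (a * a) := by
      rw [← hdet, hBdet]; push_cast; ring
    push_cast
    field_simp
    linarith
  obtain ⟨x, k, hx, hxm⟩ := exists_dvd_pow_add_one D.level_spec.1.ne' h4 hm4 hcop hmsq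
  exact D.conj_gaussSum_sq_ne hodd (D.conj_gaussSum_sq_of_forall_weilRep_eq
    (by exact_mod_cast hm') hβmat h01 h10 hcomm' htu hmt hx hxm)

end

end DiscriminantForm

theorem mainTheorem4 {A : Type*} [AddCommGroup A] [Fintype A] [DecidableEq A]
    (D : DiscriminantForm A) (hodd : Odd D.signature) (κ : ℤ)
    (α : Metaplectic) (r : (ZMod D.level)ˣ) (u : Matrix.unitaryGroup A ℂ)
    (hξ : (α, r, u) ∈ D.groupQ2) :
    (D.heckeCosets (α, r, u)).Finite ∧
      ((¬ ∃ x : ℚ, α.mat.det.val = (x : ℝ) ^ 2) →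
        ∀ f ∈ D.modularForms κ, D.hecke κ (α, r, u) f = 0) := by
  have hfin := D.heckeCosets_finite hξ
  refine ⟨hfin, fun hsq f hf => ?_⟩
  obtain ⟨n, B, g₀, s, c, hB, hs, hu⟩ := D.exists_of_mem_groupQ2 hξ
  obtain ⟨g, g', hg, hne⟩ := D.exists_weilRep_mul_ne hodd hB hs hsq
  obtain ⟨ζ, hζ⟩ := D.exists_weilRep_mul_eq_smul hB hs hg
  refine D.hecke_eq_zero hfin hg (D.mul_weilRep_eq_smul hu hζ) ?_ hf
  rintro rfl
  exact hne (Subtype.ext (by rw [hζ, one_smul]))
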